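/- Let $\sigma:\mathbb R\to\mathbb R$ be a fixed continuous function that is not a polynomial, let $\nu,d_V,d_U$ be non-negative integers, and put $V=L^2(\mathbb R^\nu,\mathbb R^{d_V})$, $U=L^2(\mathbb R^\nu,\mathbb R^{d_U})$. The group $\mathbb R^\nu$ acts on $V$ and $U$ by $(R_\gamma\Phi)(\theta)=\Phi(\theta-\gamma)$, and $f:V\to U$ is called $\mathbb R^\nu$-equivariant if $f(R_\gamma\Phi)=R_\gamma f(\Phi)$ for all $\gamma\in\mathbb R^\nu$, $\Phi\in V$. For an integer $L\ge 0$ let $Z_L=\{\mathbf k\in\mathbb Z^\nu:\|\mathbf k\|_\infty\le L\}$, and for $\lambda>0$, $\mathbf k\in\mathbb Z^\nu$ let $Q^{(\lambda)}_{\mathbf k}=\prod_{s=1}^\nu[(k_s-\tfrac12)\lambda,(k_s+\tfrac12)\lambda)$. A function $Z_N\to\mathbb R^d$ is identified with the element of $L^2(\mathbb R^\nu,\mathbb R^d)$ that takes its value at $\mathbf k$ on $Q^{(\lambda)}_{\mathbf k}$, $\mathbf k\in Z_N$, and vanishes elsewhere; the orthogonal projection of $\Phi\in L^2(\mathbb R^\nu,\mathbb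 R^d)$ to the space of these functions has the values $\lambda^{-\nu}\int_{Q^{(\lambda)}_{\mathbf k}}\Phi(\theta)\,d\theta$, $\mathbf k\in Z_N$. A *basic convnet* with receptive field parameter $L_{\rm rf}\in\{1,2,\ldots\}$, grid spacing $\lambda>0$ and range $\Lambda\ge 0$ is a map $\widehat f:V\to U$ obtained as follows. Let $N=\lfloor\Lambda/\lambda\rfloor$, choose a depth $T\ge 1$, feature dimensions $d_1,\ldots,d_{T+1}$ with $d_1=d_V$ and $d_{T+1}=d_U$, and real coefficients $w^{(t)}_{n\theta k}$ ($1\le t<T$, $\theta\in Z_{L_{\rm rf}}$), $w^{(T)}_{nk}$, $h^{(t)}_n$. Then $\widehat f$ is the composition of the orthogonal projection of $V$ to the space $W_1$ of functions $Z_{N+(T-1)L_{\rm rf}}\to\mathbb R^{d_V}$, the layers $$\widehat f_t(\Phi)_{\gamma n}=\sigma\Big(\sum_{\theta\in Z_{L_{\rm rf}}}\sum_{k=1}^{d_t}w^{(t)}_{n\theta k}\Phi_{\gamma+\theta,k}+h^{(t)}_n\Big),\qquad \gamma\in Z_{N+(T-t-1)L_{\rm rf}},\ 1\le n\le d_{t+1},\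 1\le t<T,$$ the last layer $$\widehat f_T(\Phi)_{\gamma n}=\sum_{k=1}^{d_T}w^{(T)}_{nk}\Phi_{\gamma k}+h^{(T)}_n,\qquad \gamma\in Z_N,\ 1\le n\le d_U,$$ and the inclusion of the functions $Z_N\to\mathbb R^{d_U}$ in $U$. A map $f:V\to U$ is a *limit point of basic convnets* if for every integer $L_{\rm rf}\ge 1$, every compact set $K\subset V$ and all $\epsilon,\lambda_0,\Lambda_0>0$ there is a basic convnet $\widehat f$ with receptive field parameter $L_{\rm rf}$, spacing $\lambda\le\lambda_0$ and range $\Lambda\ge\Lambda_0$ such that $\sup_{\Phi\in K}\|\widehat f(\Phi)-f(\Phi)\|<\epsilon$. **Theorem.** A map $f:V\to U$ is a limit point of basic convnets if and only if $f$ is $\mathbb R^\nu$-equivariant and continuous in the norm topology. -/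

import Mathlib

open MeasureTheory

noncomputable section

/-- The Hilbert space `L²(ℝ^ν, ℝ^d)` of `d`-component signals on `ℝ^ν` with Lebesgue measure;
the values lie in `ℝ^d` with its Euclidean inner product. -/
abbrev L2Signal (ν d : ℕ) : Type :=
  Lp (EuclideanSpace ℝ (Fin d)) 2 (volume : Measure (Fin ν → ℝ))

/-- The translation `(R_γ Φ)(θ) = Φ(θ - γ)`. -/
def translateL2 {ν d : ℕ} (γ : Fin ν → ℝ) (Φ : L2Signal ν d) : L2Signal ν d :=
  Lp.compMeasurePreserving (fun θ => θ - γ) (measurePreserving_sub_right volume γ) Φ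

/-- `ℝ^ν`-equivariance of a (not necessarily linear or continuous) map of signals. -/
def IsTranslationEquivariant {ν dV dU : ℕ} (f : L2Signal ν dV → L2Signal ν dU) : Prop :=
  ∀ (γ : Fin ν → ℝ) (Φ : L2Signal ν dV), f (translateL2 γ Φ) = translateL2 γ (f Φ)

/-- The cube `Z_L = {k ∈ ℤ^ν : ‖k‖_∞ ≤ L}` of the integer grid. -/
def gridCube (ν L : ℕ) : Finset (Fin ν → ℤ) :=
  Fintype.piFinset fun _ => Finset.Icc (-(L : ℤ)) (L : ℤ)

/-- The cube of side `lam` centred at the grid point `lam * k` (half-open, so that these cubes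
partition `ℝ^ν`). -/
def gridCell {ν : ℕ} (lam : ℝ) (k : Fin ν → ℤ) : Set (Fin ν → ℝ) :=
  Set.univ.pi fun s => Set.Ico (((k s : ℝ) - 1 / 2) * lam) (((k s : ℝ) + 1 / 2) * lam)

theorem measurableSet_gridCell {ν : ℕ} (lam : ℝ) (k : Fin ν → ℤ) :
    MeasurableSet (gridCell lam k) :=
  MeasurableSet.univ_pi fun _ => measurableSet_Ico

theorem volume_gridCell_ne_top {ν : ℕ} (lam : ℝ) (k : Fin ν → ℤ) :
    volume (gridCell lam k) ≠ ⊤ := by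
  rw [gridCell, volume_pi_pi]
  exact ENNReal.prod_ne_top fun s _ => by simp [Real.volume_Ico]

/-- A `d`-component signal on the grid; `Φ k n` is the value of the `n`-th component at the
node `lam * k`. Signals on a cube `Z_N` are extended by zero. -/
abbrev GridSignal (ν d : ℕ) : Type := (Fin ν → ℤ) → Fin d → ℝ

/-- The coordinates, on the grid `lam * ℤ^ν` restricted to `Z_N`, of the orthogonal projection of
an `L²` signal to the signals that are constant on the grid cubes with index in `Z_N` and vanish
outside them: the averages over these cubes. -/
def discretize {ν d : ℕ} (lam : ℝ) (N : ℕ) (Φ : L2Signal ν d) : GridSignal ν d :=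
  fun k n => if k ∈ gridCube ν N then ((lam ^ ν)⁻¹ • ∫ θ in gridCell lam k, Φ θ) n else 0

/-- A signal on the nodes of `Z_N`, regarded as an `L²` signal that is constant on the grid cubes
with index in `Z_N` and vanishes outside them. -/
def gridToL2 {ν d : ℕ} (lam : ℝ) (N : ℕ) (Φ : GridSignal ν d) : L2Signal ν d :=
  ∑ k ∈ gridCube ν N, indicatorConstLp 2 (measurableSet_gridCell lam k)
    (volume_gridCell_ne_top lam k) (WithLp.toLp 2 (Φ k))

/-- A nonlinear convolutional layer with activation `σ` and receptive field `Z_L`, with output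
on `Z_N`. Only the weights `w n θ k` with `θ ∈ Z_L` are used. -/
def convLayer {ν d d' : ℕ} (σ : ℝ → ℝ) (L N : ℕ) (w : Fin d' → (Fin ν → ℤ) → Fin d → ℝ)
    (h : Fin d' → ℝ) (Φ : GridSignal ν d) : GridSignal ν d' :=
  fun γ n =>
    if γ ∈ gridCube ν N then σ (∑ θ ∈ gridCube ν L, ∑ k, w n θ k * Φ (γ + θ) k + h n) else 0

/-- The last layer: an affine map applied at every node of `Z_N`, without nonlinearity. -/
def outputLayer {ν d d' : ℕ} (N : ℕ) (w : Fin d' → Fin d → ℝ) (h : Fin d' → ℝ)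
    (Φ : GridSignal ν d) : GridSignal ν d' :=
  fun γ n => if γ ∈ gridCube ν N then ∑ k, w n k * Φ γ k + h n else 0

/-- The coefficients of a chain of layers `f₁, …, f_T` (`T ≥ 1`) with input feature dimension `d`,
output feature dimension `e` and arbitrary intermediate feature dimensions: finitely many
(possibly zero) nonlinear convolutional layers followed by one affine output layer. -/
inductive ConvLayers (ν : ℕ) : ℕ → ℕ → Type
  | output {d e : ℕ} (w : Fin e → Fin d → ℝ) (h : Fin e → ℝ) : ConvLayers ν d e
  | conv {d d' e : ℕ} (w : Fin d' → (Fin ν → ℤ) → Fin d → ℝ) (h : Fin d' → ℝ)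
      (rest : ConvLayers ν d' e) : ConvLayers ν d e

/-- The number `T - 1` of nonlinear layers in a chain of `T` layers. -/
def ConvLayers.hiddenDepth {ν : ℕ} : {d e : ℕ} → ConvLayers ν d e → ℕ
  | _, _, .output _ _ => 0
  | _, _, .conv _ _ rest => rest.hiddenDepth + 1

/-- The composition `f_T ∘ ⋯ ∘ f₁` on grid signals. The input lives on `Z_{N + (T - 1) L}`, every
nonlinear layer shrinks the grid by `L`, and the output lives on `Z_N`. -/
def ConvLayers.run {ν : ℕ} (σ : ℝ → ℝ) (L N : ℕ) :
    {d e : ℕ} → ConvLayers ν d e → GridSignal ν d → GridSignal ν e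
  | _, _, .output w h, Φ => outputLayer N w h Φ
  | _, _, .conv w h rest, Φ =>
      rest.run σ L N (convLayer σ L (N + rest.hiddenDepth * L) w h Φ)

/-- The basic convnet with activation `σ`, receptive field parameter `Lrf`, grid spacing `lam`,
range `Lam` and the given layers: projection to the grid signals on
`Z_{⌊Lam / lam⌋ + (T - 1) Lrf}`, then the layers, then the inclusion of the grid signals
on `Z_{⌊Lam / lam⌋}` in `L²`. -/
def basicConvnet {ν dV dU : ℕ} (σ : ℝ → ℝ) (Lrf : ℕ) (lam Lam : ℝ)
    (net : ConvLayers ν dV dU) (Φ : L2Signal ν dV) : L2Signal ν dU :=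
  gridToL2 lam ⌊Lam / lam⌋₊
    (net.run σ Lrf ⌊Lam / lam⌋₊
      (discretize lam (⌊Lam / lam⌋₊ + net.hiddenDepth * Lrf) Φ))

/-- `f` is a limit point of basic convnets. The supremum is taken in `[0, ∞]`. -/
def IsLimitPointOfBasicConvnets {ν dV dU : ℕ} (σ : ℝ → ℝ)
    (f : L2Signal ν dV → L2Signal ν dU) : Prop :=
  ∀ Lrf : ℕ, 0 < Lrf → ∀ K : Set (L2Signal ν dV), IsCompact K →
    ∀ ε lam₀ Lam₀ : ℝ, 0 < ε → 0 < lam₀ → 0 < Lam₀ →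
      ∃ lam Lam : ℝ, 0 < lam ∧ lam ≤ lam₀ ∧ Lam₀ ≤ Lam ∧
        ∃ net : ConvLayers ν dV dU,
          (⨆ Φ ∈ K, ‖basicConvnet σ Lrf lam Lam net Φ - f Φ‖ₑ) < ENNReal.ofReal ε

end

/-!
**Convnets produce exactly the continuous equivariant maps.**

*Limit points are continuous and equivariant.* Each basic convnet is continuous, so its limits,
uniform on compact sets, are continuous. The output of the layers at a node depends only on the
input in a cube around that node, by a rule that is the same at all nodes
(`ConvLayers.run_congr`); hence a convnet commutes with translations by grid vectors `lam * m`,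
except near the boundary of its grid. With `lam → 0`, `lam * m → γ` and the range tending to
infinity, the difference `f (R_γ Φ) - R_γ (f Φ)` is orthogonal to the indicators of all bounded
cells (`inner_basicConvnet_translateL2`), so it vanishes.

*Continuous equivariant maps are limit points.* Write `P_N` for the orthogonal projection to the
grid signals on `Z_N` and `P` for the projection to the signals on the infinite grid. On a compact
set, `f Φ` is close to `P_N (f (P Φ))` when `lam` is small and `N * lam` is large. Unlike `P_N`, the
projection `P` commutes with translations by grid vectors, so by equivariance the value of
`P_N (f (P Φ))` at the node `k` is *exactly* `φ (P (R_{-lam k} Φ))`, where `φ Ψ` is the average of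
`f Ψ` over the central cell. No error is made at single nodes before `lam` is fixed; this matters,
as the number of nodes grows when `lam → 0`. For fixed `lam` and `N` one may replace `P` by `P_M`
with `M` large: what remains is to approximate one continuous function of the window `k + Z_M` at
finitely many nodes `k` (`exists_convLayers_approx`). One hidden layer sees only `Z_L`; a chain of
`m + 1` of them sees `Z_{(m + 1) L}` if its first layers approximately copy the neighbouring values.

The approximation by one hidden layer is the theorem of Leshno, Lin, Pinkus and Schocken, proved
here in `C(X, ℝ)` for a compact space `X` (`topologicalClosure_span_ridge_eq_top`). Let `T` be the
closed span of the functions `σ (u + b)`, with `u` in a subspace `E` that separates points. `T`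
also contains `τ (w u + b)` for each mollification `τ` of `σ`, and, by differentiation in `w` at
`w = 0`, the functions `τ⁽ᵏ⁾(b) u ^ k`. If `u ^ k ∉ T`, then `τ⁽ᵏ⁾ = 0` for all `τ`, so that `σ` is
a limit of polynomials of degree `< k`, hence a polynomial. So `T` contains the powers of `u` and thus
`exp u`; the exponentials of `E` span a subalgebra, and the Stone–Weierstrass theorem applies.
-/

noncomputable section

/-! ### Polynomials as limits -/

open Filter Topology in
/-- Polynomials of degree `< k` are closed under pointwise limits: Lagrange interpolation at `k`
nodes expresses the values through those at the nodes. -/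
theorem exists_polynomial_of_tendsto {k : ℕ} {F : ℕ → ℝ → ℝ} {g : ℝ → ℝ}
    (hF : ∀ n, ∃ p : Polynomial ℝ, p.degree < k ∧ ∀ x, F n x = p.eval x)
    (hg : ∀ x, Tendsto (fun n => F n x) atTop (𝓝 (g x))) :
    ∃ p : Polynomial ℝ, ∀ x, g x = p.eval x := by
  classical
  let v : ℕ → ℝ := fun i => i
  have hv : Set.InjOn v (Finset.range k : Finset ℕ) := fun a _ b _ h => Nat.cast_injective h
  refine ⟨Lagrange.interpolate (Finset.range k) v (fun i => g (v i)), fun x => ?_⟩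
  refine tendsto_nhds_unique (hg x) ?_
  have key : ∀ n, F n x
      = ∑ i ∈ Finset.range k, F n (v i) * (Lagrange.basis (Finset.range k) v i).eval x := by
    intro n
    obtain ⟨p, hp, hpF⟩ := hF n
    have := Lagrange.eq_interpolate (s := Finset.range k) (f := p) hv (by simpa using hp)
    rw [hpF, this, Lagrange.interpolate_apply, Polynomial.eval_finsetSum]
    refine Finset.sum_congr rfl fun i _ => ?_
    rw [Polynomial.eval_mul, Polynomial.eval_C, hpF]
  simp only [key]
  rw [Lagrange.interpolate_apply, Polynomial.eval_finsetSum]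
  simp only [Polynomial.eval_mul, Polynomial.eval_C]
  exact tendsto_finsetSum _ fun i _ => (hg _).mul_const _

theorem exists_polynomial_of_iteratedDeriv_eq_zero (k : ℕ) (f : ℝ → ℝ) (hf : ContDiff ℝ (⊤ : ℕ∞) f)
    (h : ∀ x, iteratedDeriv k f x = 0) :
    ∃ p : Polynomial ℝ, p.degree < k ∧ ∀ x, f x = p.eval x := by
  suffices H : ∃ c : ℕ → ℝ, ∀ x, f x = ∑ i ∈ Finset.range k, c i * x ^ i by
    obtain ⟨c, hc⟩ := H
    refine ⟨∑ i : Fin k, Polynomial.C (c i) * Polynomial.X ^ (i : ℕ),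
      Polynomial.degree_sum_fin_lt fun i : Fin k => c i, fun x => ?_⟩
    rw [hc, Polynomial.eval_finsetSum, Finset.sum_range]
    simp
  induction k generalizing f with
  | zero => exact ⟨0, fun x => by simpa using h x⟩
  | succ k ih =>
    have hf' : ContDiff ℝ (⊤ : ℕ∞) (deriv f) := ((contDiff_infty_iff_deriv).1 hf).2
    obtain ⟨c, hc⟩ := ih (deriv f) hf' fun x => by rw [← iteratedDeriv_succ']; exact h x
    refine ⟨fun i => Nat.casesOn i (f 0) fun j => c j / (j + 1), fun x => ?_⟩
    rw [Finset.sum_range_succ']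
    have hd : Differentiable ℝ f := ((contDiff_infty_iff_deriv).1 hf).1
    have hder : ∀ y, HasDerivAt (fun x => f x - ∑ i ∈ Finset.range k,
        c i / (i + 1) * x ^ (i + 1)) 0 y := by
      intro y
      have h1 := (hd y).hasDerivAt
      have h2 : HasDerivAt (fun x : ℝ => ∑ i ∈ Finset.range k, c i / (i + 1) * x ^ (i + 1))
          (∑ i ∈ Finset.range k, c i * y ^ i) y := by
        refine HasDerivAt.fun_sum fun i _ => ?_
        have h3 := (hasDerivAt_pow (i + 1) y).const_mul (c i / (i + 1))
        convert! h3 using 1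
        have : (i : ℝ) + 1 ≠ 0 := by positivity
        push_cast
        field_simp
      have h3 := h1.sub h2
      rwa [hc, sub_self] at h3
    have := is_const_of_deriv_eq_zero (fun y => (hder y).differentiableAt)
      (fun y => (hder y).deriv) x 0
    simp at this
    simp
    linarith

/-! ### Universal approximation by shallow networks -/

section Ridge

variable {X : Type*} [TopologicalSpace X]

/-- The functions `x ↦ g (w * u x + b)` in `C(X, ℝ)`. -/
def ridge (g : C(ℝ, ℝ)) (u : C(X, ℝ)) (w b : ℝ) : C(X, ℝ) :=
  g.comp (w • u + ContinuousMap.const X b)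

@[simp] theorem ridge_apply (g : C(ℝ, ℝ)) (u : C(X, ℝ)) (w b : ℝ) (x : X) :
    ridge g u w b x = g (w * u x + b) := rfl

/-- A Bochner integral of a continuous, integrable curve in a closed subspace of a Banach space
stays in that subspace. -/
theorem Submodule.integral_mem_of_isClosed {E : Type*} [NormedAddCommGroup E] [NormedSpace ℝ E]
    [CompleteSpace E] {T : Submodule ℝ E} (hT : IsClosed (T : Set E)) {F : ℝ → E}
    {μ : Measure ℝ} (hF : ∀ y, F y ∈ T) (hi : Integrable F μ) : ∫ y, F y ∂μ ∈ T := by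
  have : IsClosed (T : Set E) := hT
  have h0 : T.mkQL (∫ y, F y ∂μ) = 0 := by
    rw [← ContinuousLinearMap.integral_comp_comm _ hi]
    have : ∀ y, T.mkQL (F y) = 0 := fun y => (Submodule.Quotient.mk_eq_zero T).2 (hF y)
    simp [this]
  exact (Submodule.Quotient.mk_eq_zero T).1 h0

theorem continuous_ridge_shift (g : C(ℝ, ℝ)) (u : C(X, ℝ)) (w b : ℝ) :
    Continuous fun y => ridge g u w (b - y) := by
  refine ContinuousMap.continuous_of_continuous_uncurry _ ?_
  simp only [Function.uncurry_def, ridge_apply]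
  fun_prop

variable [CompactSpace X]

/-- A closed subspace that contains the ridge functions of `σ` contains those of the
mollifications of `σ`. -/
theorem ridge_convolution_mem {T : Submodule ℝ C(X, ℝ)} (hT : IsClosed (T : Set C(X, ℝ)))
    (σ : C(ℝ, ℝ)) (u : C(X, ℝ)) (hσ : ∀ w b, ridge σ u w b ∈ T) (φ : ℝ → ℝ)
    (hφ : Continuous φ) (hφc : HasCompactSupport φ) (τ : C(ℝ, ℝ))
    (hτ : ∀ t, τ t = ∫ s, φ s * σ (t - s)) (w b : ℝ) : ridge τ u w b ∈ T := by
  have hc : Continuous fun s => φ s • ridge σ u w (b - s) :=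
    hφ.smul (continuous_ridge_shift σ u w b)
  have hi : Integrable fun s => φ s • ridge σ u w (b - s) :=
    hc.integrable_of_hasCompactSupport hφc.smul_right
  have : ridge τ u w b = ∫ s, φ s • ridge σ u w (b - s) := by
    ext x
    rw [ContinuousMap.integral_apply hi]
    simp [hτ, add_sub_assoc]
  rw [this]
  exact Submodule.integral_mem_of_isClosed hT (fun s => T.smul_mem _ (hσ _ _)) hi

/-- Differentiating ridge functions in the weight: `d/dw g (w u + b) = u * g' (w u + b)`. -/
theorem hasDerivAt_pow_mul_ridge (g g' : C(ℝ, ℝ)) (hg : ∀ t, HasDerivAt g (g' t) t)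
    (u : C(X, ℝ)) (j : ℕ) (w b : ℝ) :
    HasDerivAt (fun w => u ^ j * ridge g u w b) (u ^ (j + 1) * ridge g' u w b) w := by
  have hc : Continuous fun w => u ^ (j + 1) * ridge g' u w b := by
    refine ContinuousMap.continuous_of_continuous_uncurry _ ?_
    simp only [Function.uncurry_def, ridge_apply, ContinuousMap.mul_apply, ContinuousMap.pow_apply]
    fun_prop
  -- Writing the curve as an integral, pointwise in `X`, gives differentiability in `C(X, ℝ)`.
  have key : (fun w => u ^ j * ridge g u w b) = fun w =>
      u ^ j * ridge g u 0 b + ∫ v in (0 : ℝ)..w, u ^ (j + 1) * ridge g' u v b := by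
    funext w
    ext x
    have h1 : (∫ v in (0 : ℝ)..w, u ^ (j + 1) * ridge g' u v b) x
        = ∫ v in (0 : ℝ)..w, (u ^ (j + 1) * ridge g' u v b) x :=
      ((ContinuousMap.evalCLM ℝ x).intervalIntegral_comp_comm
        (hc.intervalIntegrable 0 w)).symm
    have h2 : ∫ v in (0 : ℝ)..w, (u ^ (j + 1) * ridge g' u v b) x
        = (u ^ j * ridge g u w b) x - (u ^ j * ridge g u 0 b) x := by
      refine intervalIntegral.integral_eq_sub_of_hasDerivAt
        (f := fun v => (u ^ j * ridge g u v b) x) (fun v _ => ?_) ?_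
      · simp only [ContinuousMap.mul_apply, ridge_apply, ContinuousMap.pow_apply]
        have h3 : HasDerivAt (fun v : ℝ => v * u x + b) (u x) v := by
          simpa using ((hasDerivAt_id v).mul_const (u x)).add_const b
        have h4 := ((hg (v * u x + b)).comp v h3).const_mul (u x ^ j)
        convert! h4 using 1
        ring
      · exact (((ContinuousMap.evalCLM ℝ x).continuous).comp hc).intervalIntegrable _ _
    rw [ContinuousMap.add_apply, h1, h2]
    ring
  rw [key]
  exact (intervalIntegral.integral_hasDerivAt_right (hc.intervalIntegrable _ _)
    (hc.stronglyMeasurableAtFilter _ _) hc.continuousAt).const_add _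

/-- The derivative of a curve in a closed subspace lies in that subspace. -/
theorem HasDerivAt.mem_of_isClosed {E : Type*} [NormedAddCommGroup E] [NormedSpace ℝ E]
    {T : Submodule ℝ E} (hT : IsClosed (T : Set E)) {F : ℝ → E} {F' : E} {t : ℝ}
    (hF : ∀ y, F y ∈ T) (h : HasDerivAt F F' t) : F' ∈ T := by
  rw [hasDerivAt_iff_tendsto_slope] at h
  refine hT.mem_of_tendsto h (Filter.Eventually.of_forall fun y => ?_)
  exact T.smul_mem _ (T.sub_mem (hF _) (hF _))

/-- A closed subspace that contains the ridge functions of a smooth `τ` contains their derivatives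
in the weight. -/
theorem pow_mul_ridge_iteratedDeriv_mem {T : Submodule ℝ C(X, ℝ)}
    (hT : IsClosed (T : Set C(X, ℝ))) (u : C(X, ℝ)) (τ : ℝ → ℝ) (hτ : ContDiff ℝ (⊤ : ℕ∞) τ)
    (hmem : ∀ w b, ridge ⟨τ, hτ.continuous⟩ u w b ∈ T) (j : ℕ) (w b : ℝ) :
    u ^ j * ridge ⟨iteratedDeriv j τ, hτ.continuous_iteratedDeriv j (mod_cast le_top)⟩ u w b
      ∈ T := by
  induction j generalizing w b with
  | zero => simpa using hmem w b
  | succ j ih =>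
    refine HasDerivAt.mem_of_isClosed hT (fun w => ih w b)
      (hasDerivAt_pow_mul_ridge _ _ (fun t => ?_) u j w b)
    simp only [ContinuousMap.coe_mk, iteratedDeriv_succ]
    exact ((hτ.differentiable_iteratedDeriv j (mod_cast ENat.natCast_lt_top j)) t).hasDerivAt

open Filter Topology in
/-- Powers of `u` are limits of ridge functions of a continuous non-polynomial `σ`. If `u ^ k`
were missing, the `k`-th derivative of every mollification of `σ` would vanish, and `σ`
would be a limit of polynomials of degree `< k`. -/
theorem pow_mem_of_ridge_mem {T : Submodule ℝ C(X, ℝ)} (hT : IsClosed (T : Set C(X, ℝ)))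
    (σ : C(ℝ, ℝ)) (hσ : ¬ ∃ p : Polynomial ℝ, ∀ x : ℝ, σ x = p.eval x) (u : C(X, ℝ))
    (hmem : ∀ w b, ridge σ u w b ∈ T) (k : ℕ) : u ^ k ∈ T := by
  by_contra hk
  apply hσ
  let φ : ℕ → ContDiffBump (0 : ℝ) := fun n =>
    ⟨1 / (2 * (n + 1)), 1 / (n + 1), by positivity, by
      apply one_div_lt_one_div_of_lt <;> nlinarith [n.cast_nonneg (α := ℝ)]⟩
  let F : ℕ → ℝ → ℝ := fun n =>
    convolution ((φ n).normed volume) σ (ContinuousLinearMap.lsmul ℝ ℝ) volume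
  have hFd : ∀ n, ContDiff ℝ (⊤ : ℕ∞) (F n) := fun n =>
    (φ n).hasCompactSupport_normed.contDiff_convolution_left _ (φ n).contDiff_normed
      σ.continuous.locallyIntegrable
  refine exists_polynomial_of_tendsto (k := k) (F := F) (fun n => ?_) (fun x => ?_)
  · refine exists_polynomial_of_iteratedDeriv_eq_zero k (F n) (hFd n) fun b => ?_
    by_contra hb
    have hr := pow_mul_ridge_iteratedDeriv_mem hT u (F n) (hFd n)
      (ridge_convolution_mem hT σ u hmem _ (φ n).continuous_normed
        (φ n).hasCompactSupport_normed _ fun t => rfl) k 0 b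
    apply hk
    -- At weight `w = 0` the ridge function is the nonzero constant `iteratedDeriv k (F n) b`.
    have : u ^ k = (iteratedDeriv k (F n) b)⁻¹ • (u ^ k * ridge ⟨iteratedDeriv k (F n),
        (hFd n).continuous_iteratedDeriv k (mod_cast le_top)⟩ u 0 b) := by
      ext x
      simp
      field_simp
    rw [this]
    exact T.smul_mem _ hr
  · refine ContDiffBump.convolution_tendsto_right_of_continuous ?_ σ.continuous x
    exact tendsto_one_div_add_atTop_nhds_zero_nat

theorem exp_mem_of_pow_mem {T : Submodule ℝ C(X, ℝ)} (hT : IsClosed (T : Set C(X, ℝ)))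
    (u : C(X, ℝ)) (hu : ∀ k, u ^ k ∈ T) : NormedSpace.exp u ∈ T :=
  hT.mem_of_tendsto (NormedSpace.exp_series_hasSum_exp' (𝕂 := ℝ) u)
    (Filter.Eventually.of_forall fun _ => T.sum_mem fun k _ => T.smul_mem _ (hu k))

/-- **Density of ridge functions.** If `σ` is continuous and not a polynomial, and the subspace
`E` of `C(X, ℝ)` separates points, then the functions `σ (u + b)`, `u ∈ E`, span a dense subspace.
The span of the exponentials of `E` is a subalgebra, to which the Stone–Weierstrass theorem
applies. -/
theorem topologicalClosure_span_ridge_eq_top (σ : C(ℝ, ℝ))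
    (hσ : ¬ ∃ p : Polynomial ℝ, ∀ x : ℝ, σ x = p.eval x) (E : Submodule ℝ C(X, ℝ))
    (hE : ∀ x y : X, x ≠ y → ∃ u ∈ E, u x ≠ u y) :
    (Submodule.span ℝ {g : C(X, ℝ) | ∃ u ∈ E, ∃ b, g = ridge σ u 1 b}).topologicalClosure = ⊤ := by
  set T := (Submodule.span ℝ
    {g : C(X, ℝ) | ∃ u ∈ E, ∃ b, g = ridge σ u 1 b}).topologicalClosure with hTdef
  have hT : IsClosed (T : Set C(X, ℝ)) := Submodule.isClosed_topologicalClosure _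
  have hmem : ∀ u ∈ E, ∀ w b, ridge σ u w b ∈ T := by
    intro u hu w b
    refine Submodule.le_topologicalClosure _ (Submodule.subset_span ⟨w • u, E.smul_mem _ hu, b, ?_⟩)
    ext x
    simp
  have hexp : ∀ u ∈ E, NormedSpace.exp u ∈ T := fun u hu =>
    exp_mem_of_pow_mem hT u (pow_mem_of_ridge_mem hT σ hσ u (hmem u hu))
  let M : Submonoid C(X, ℝ) :=
    { carrier := {g | ∃ u ∈ E, g = NormedSpace.exp u}
      one_mem' := ⟨0, E.zero_mem, NormedSpace.exp_zero.symm⟩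
      mul_mem' := by
        rintro _ _ ⟨u, hu, rfl⟩ ⟨v, hv, rfl⟩
        exact ⟨u + v, E.add_mem hu hv, (NormedSpace.exp_add_of_commute (Commute.all u v)).symm⟩ }
  let A : Subalgebra ℝ C(X, ℝ) := Algebra.adjoin ℝ (M : Set C(X, ℝ))
  have hA : Subalgebra.toSubmodule A ≤ T := by
    rw [Algebra.adjoin_eq_span, Submonoid.closure_eq, Submodule.span_le]
    rintro _ ⟨u, hu, rfl⟩
    exact hexp u hu
  have hsep : A.SeparatesPoints := by
    intro x y hxy
    obtain ⟨u, hu, hne⟩ := hE x y hxy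
    refine ⟨_, ⟨NormedSpace.exp u, Algebra.subset_adjoin ⟨u, hu, rfl⟩, rfl⟩, ?_⟩
    have hev : ∀ z : X, (NormedSpace.exp u : C(X, ℝ)) z = Real.exp (u z) := by
      intro z
      rw [Real.exp_eq_exp_ℝ]
      exact NormedSpace.map_exp (ContinuousMap.evalAlgHom ℝ ℝ z)
        (ContinuousMap.evalCLM ℝ z).continuous u
    change (NormedSpace.exp u : C(X, ℝ)) x ≠ (NormedSpace.exp u : C(X, ℝ)) y
    rw [hev, hev]
    exact fun h => hne (Real.exp_injective h)
  have htop := ContinuousMap.subalgebra_topologicalClosure_eq_top_of_separatesPoints A hsep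
  rw [eq_top_iff]
  intro g _
  have hg : g ∈ A.topologicalClosure := by rw [htop]; trivial
  exact closure_minimal hA hT hg

end Ridge

/-- **Universal approximation by shallow networks** with a continuous non-polynomial activation,
uniformly on a cube. -/
theorem exists_shallow_network_approx {σ : ℝ → ℝ} (hσc : Continuous σ)
    (hσ : ¬ ∃ p : Polynomial ℝ, ∀ x : ℝ, σ x = p.eval x) {p q : Type*} [Fintype p] [Fintype q]
    (F : (p → ℝ) → q → ℝ) (hF : Continuous F) (B : ℝ) {ε : ℝ} (hε : 0 < ε) :
    ∃ (n : ℕ) (W : Fin n → p → ℝ) (h : Fin n → ℝ) (A : q → Fin n → ℝ),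
      ∀ x : p → ℝ, (∀ i, |x i| ≤ B) → ∀ j,
        |∑ i, A j i * σ (∑ k, W i k * x k + h i) - F x j| < ε := by
  classical
  let K : Set (p → ℝ) := Set.univ.pi fun _ => Set.Icc (-B) B
  have : CompactSpace K := isCompact_iff_compactSpace.1
    (isCompact_univ_pi fun _ => isCompact_Icc)
  let E : Submodule ℝ C(K, ℝ) :=
    { carrier := {u | ∃ a : p → ℝ, ∀ x : K, u x = ∑ k, a k * x.1 k}
      zero_mem' := ⟨0, fun x => by simp⟩
      add_mem' := by
        rintro u v ⟨a, ha⟩ ⟨b, hb⟩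
        exact ⟨a + b, fun x => by simp [ha, hb, add_mul, Finset.sum_add_distrib]⟩
      smul_mem' := by
        rintro c u ⟨a, ha⟩
        exact ⟨c • a, fun x => by simp [ha, mul_assoc, Finset.mul_sum]⟩ }
  have hE : ∀ x y : K, x ≠ y → ∃ u ∈ E, u x ≠ u y := by
    intro x y hxy
    obtain ⟨k, hk⟩ : ∃ k, x.1 k ≠ y.1 k := by
      by_contra! h
      exact hxy (Subtype.ext (funext h))
    exact ⟨⟨fun x => x.1 k, (continuous_apply k).comp continuous_subtype_val⟩,
      ⟨Pi.single k 1, fun x => by simp [Pi.single_apply]⟩, hk⟩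
  have htop := topologicalClosure_span_ridge_eq_top ⟨σ, hσc⟩ hσ E hE
  have hscalar : ∀ j : q, ∃ (n : ℕ) (W : Fin n → p → ℝ) (h : Fin n → ℝ) (A : Fin n → ℝ),
      ∀ x : K, |∑ i, A i * σ (∑ k, W i k * x.1 k + h i) - F x j| < ε := by
    intro j
    let G : C(K, ℝ) := ⟨fun x => F x j, by fun_prop⟩
    have hG : G ∈ (Submodule.span ℝ {g : C(K, ℝ) | ∃ u ∈ E, ∃ b,
        g = ridge ⟨σ, hσc⟩ u 1 b}).topologicalClosure := by rw [htop]; trivial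
    obtain ⟨g, hg, hgG⟩ := Metric.mem_closure_iff.1 hG ε hε
    obtain ⟨n, f, r, rfl⟩ := Submodule.mem_span_set'.1 hg
    have hr : ∀ i, ∃ (W : p → ℝ) (h : ℝ), ∀ x : K, (r i).1 x = σ (∑ k, W k * x.1 k + h) := by
      intro i
      obtain ⟨u, ⟨a, ha⟩, b, hb⟩ := (r i).2
      exact ⟨a, b, fun x => by rw [hb]; simp [ha]⟩
    choose W h hWh using hr
    refine ⟨n, W, h, f, fun x => ?_⟩
    have h1 := (ContinuousMap.dist_apply_le_dist x).trans_lt hgG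
    rw [dist_comm, Real.dist_eq, ContinuousMap.sum_apply] at h1
    simpa [hWh, G] using h1
  choose n W h A hA using hscalar
  -- The networks for the components of `F` are put side by side.
  let e : (Σ j : q, Fin (n j)) ≃ Fin (Fintype.card (Σ j : q, Fin (n j))) := Fintype.equivFin _
  refine ⟨_, fun i => W (e.symm i).1 (e.symm i).2, fun i => h (e.symm i).1 (e.symm i).2,
    fun j i => if (e.symm i).1 = j then A (e.symm i).1 (e.symm i).2 else 0, fun x hx j => ?_⟩
  rw [e.symm.sum_comp fun i : (Σ j : q, Fin (n j)) => (if i.1 = j then A i.1 i.2 else 0) *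
    σ (∑ k, W i.1 i.2 k * x k + h i.1 i.2), Fintype.sum_sigma, Finset.sum_eq_single j]
  · simpa using hA j ⟨x, fun i _ => abs_le.1 (hx i)⟩
  · intro b _ hb
    simp [hb]
  · simp

/-! ### Grid signals and layers -/

/-- A continuous map is uniformly continuous at the points of a compact set, where only one of the
two points to be compared has to lie in the set. -/
theorem IsCompact.exists_delta_of_continuous {α β : Type*} [PseudoMetricSpace α]
    [PseudoMetricSpace β] {f : α → β} (hf : Continuous f) {K : Set α} (hK : IsCompact K) {ε : ℝ}
    (hε : 0 < ε) : ∃ δ > 0, ∀ x ∈ K, ∀ y, dist x y < δ → dist (f x) (f y) < ε := by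
  have h := hK.uniformContinuousAt_of_continuousAt f (fun a _ => hf.continuousAt)
    (Metric.dist_mem_uniformity hε)
  obtain ⟨δ, hδ, h⟩ := Metric.mem_uniformity_dist.1 h
  exact ⟨δ, hδ, fun x hx y hxy => h hxy hx⟩

section Grid

variable {ν : ℕ}

theorem mem_gridCube {N : ℕ} {k : Fin ν → ℤ} : k ∈ gridCube ν N ↔ ∀ s, |k s| ≤ (N : ℤ) := by
  simp [gridCube, abs_le]

theorem zero_mem_gridCube (N : ℕ) : (0 : Fin ν → ℤ) ∈ gridCube ν N := by
  simp [mem_gridCube]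

theorem add_mem_gridCube {M N : ℕ} {a b : Fin ν → ℤ} (ha : a ∈ gridCube ν M)
    (hb : b ∈ gridCube ν N) : a + b ∈ gridCube ν (M + N) := by
  rw [mem_gridCube] at *
  intro s
  push_cast
  exact (abs_add_le _ _).trans (add_le_add (ha s) (hb s))

theorem gridCube_mono {M N : ℕ} (h : M ≤ N) : gridCube ν M ⊆ gridCube ν N := by
  intro k hk
  rw [mem_gridCube] at *
  exact fun s => (hk s).trans (by exact_mod_cast h)

/-- `Z_{M + N} = Z_M + Z_N`. -/
theorem exists_add_of_mem_gridCube {M N : ℕ} {p : Fin ν → ℤ} (hp : p ∈ gridCube ν (M + N)) :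
    ∃ a ∈ gridCube ν M, ∃ b ∈ gridCube ν N, a + b = p := by
  rw [mem_gridCube] at hp
  refine ⟨fun s => max (-(M : ℤ)) (min (M : ℤ) (p s)), ?_,
    fun s => p s - max (-(M : ℤ)) (min (M : ℤ) (p s)), ?_, ?_⟩
  · rw [mem_gridCube]
    intro s
    have := hp s
    grind
  · rw [mem_gridCube]
    intro s
    have := hp s
    grind
  · ext s
    simp

/-- The values of a grid signal on the translated cube `γ + Z_M`. -/
def gridWindow {d : ℕ} (M : ℕ) (Φ : GridSignal ν d) (γ : Fin ν → ℤ) :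
    gridCube ν M → Fin d → ℝ :=
  fun p => Φ (γ + p)

/-- Locality and shift equivariance of the layers: the output at a node depends only on the
input in the cube `Z_{(T - 1) L}` around it, and on neither the node nor the size of the grid. -/
theorem ConvLayers.run_congr (σ : ℝ → ℝ) (L : ℕ) {d e : ℕ} (net : ConvLayers ν d e) {N N' : ℕ}
    {Φ Φ' : GridSignal ν d} {γ γ' : Fin ν → ℤ} (hγ : γ ∈ gridCube ν N)
    (hγ' : γ' ∈ gridCube ν N')
    (h : ∀ θ ∈ gridCube ν (net.hiddenDepth * L), Φ (γ + θ) = Φ' (γ' + θ)) :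
    net.run σ L N Φ γ = net.run σ L N' Φ' γ' := by
  induction net with
  | output w b =>
    have := h 0 (zero_mem_gridCube _)
    simp only [add_zero] at this
    ext n
    simp [ConvLayers.run, outputLayer, hγ, hγ', this]
  | conv w b rest ih =>
    refine ih fun θ hθ => ?_
    ext n
    simp only [convLayer, add_mem_gridCube hγ hθ, add_mem_gridCube hγ' hθ, if_true]
    congr 2
    refine Finset.sum_congr rfl fun η hη => ?_
    rw [add_assoc, add_assoc, h]
    rw [ConvLayers.hiddenDepth, add_mul, one_mul]
    exact add_mem_gridCube hθ hη

theorem ConvLayers.continuous_run {σ : ℝ → ℝ} (hσ : Continuous σ) (L N : ℕ) {d e : ℕ}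
    (net : ConvLayers ν d e) : Continuous (net.run σ L N) := by
  induction net with
  | output w b =>
    refine continuous_pi fun γ => continuous_pi fun n => ?_
    simp only [ConvLayers.run, outputLayer]
    split_ifs <;> fun_prop
  | conv w b rest ih =>
    refine ih.comp (continuous_pi fun γ => continuous_pi fun n => ?_)
    simp only [convLayer]
    split_ifs <;> fun_prop

/-- Convolution weights from weights indexed by the positions in `Z_L` and the components. -/
def windowWeights {L d d' : ℕ} (W : Fin d' → gridCube ν L × Fin d → ℝ) :
    Fin d' → (Fin ν → ℤ) → Fin d → ℝ :=
  fun i θ k => if hθ : θ ∈ gridCube ν L then W i (⟨θ, hθ⟩, k) else 0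

/-- The convolutional layer whose features are `σ (W x + h)`, with `x` the values of the signal in
the cube `Z_L` around the node. -/
theorem convLayer_window {σ : ℝ → ℝ} {L N d d' : ℕ} (W : Fin d' → gridCube ν L × Fin d → ℝ)
    (h : Fin d' → ℝ) (Φ : GridSignal ν d) {γ : Fin ν → ℤ} (hγ : γ ∈ gridCube ν N) (i : Fin d') :
    convLayer σ L N (windowWeights W) h Φ γ i
      = σ (∑ p, W i p * gridWindow L Φ γ p.1 p.2 + h i) := by
  rw [convLayer, if_pos hγ, Fintype.sum_prod_type, ← Finset.sum_coe_sort]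
  congr 2
  refine Finset.sum_congr rfl fun θ _ => Finset.sum_congr rfl fun k _ => ?_
  rw [windowWeights, dif_pos θ.2]
  rfl

/-- Convnets approximate every continuous function `G` of the window `γ + Z_{(m + 1) L}`,
at all nodes `γ` simultaneously. In the inductive step the first layer, composed with a linear
map `A`, approximately copies the values on `γ + Z_L` to the features at `γ`; the remaining
layers approximate `G` as a function of those features on a window that is smaller by `L`. -/
theorem exists_convLayers_approx {σ : ℝ → ℝ} (hσc : Continuous σ)
    (hσ : ¬ ∃ p : Polynomial ℝ, ∀ x : ℝ, σ x = p.eval x) (L e : ℕ) (m : ℕ) {M : ℕ}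
    (hM : M = (m + 1) * L) {d : ℕ} (G : (gridCube ν M → Fin d → ℝ) → Fin e → ℝ)
    (hG : Continuous G) (B : ℝ) {ε : ℝ} (hε : 0 < ε) :
    ∃ net : ConvLayers ν d e, net.hiddenDepth = m + 1 ∧
      ∀ (N : ℕ) (Φ : GridSignal ν d), (∀ k n, |Φ k n| ≤ B) → ∀ γ ∈ gridCube ν N, ∀ n,
        |net.run σ L N Φ γ n - G (gridWindow M Φ γ) n| < ε := by
  induction m generalizing M d B ε with
  | zero =>
    obtain rfl : M = L := by simpa using hM
    obtain ⟨n, W, h, A, hA⟩ := exists_shallow_network_approx hσc hσ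
      (fun x : gridCube ν M × Fin d → ℝ => G fun p k => x (p, k)) (by fun_prop) B hε
    refine ⟨.conv (windowWeights W) h (.output A 0), by simp [ConvLayers.hiddenDepth],
      fun N Φ hΦ γ hγ j => ?_⟩
    have hγ' : γ ∈ gridCube ν (N + 0 * M) := by simpa using hγ
    simp only [ConvLayers.run, ConvLayers.hiddenDepth, outputLayer, if_pos hγ,
      convLayer_window W h Φ hγ']
    simpa using hA (fun p => gridWindow M Φ γ p.1 p.2) (fun p => hΦ _ _) j
  | succ m ih =>
    have hsplit : ∀ p : gridCube ν M, ∃ (a : gridCube ν ((m + 1) * L)) (b : gridCube ν L),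
        a.1 + b.1 = p.1 := by
      intro p
      obtain ⟨a, ha, b, hb, hab⟩ := exists_add_of_mem_gridCube (M := (m + 1) * L) (N := L)
        (p := p.1) (by rw [← add_one_mul, ← hM]; exact p.2)
      exact ⟨⟨a, ha⟩, ⟨b, hb⟩, hab⟩
    choose base off hbo using hsplit
    let K : Set (gridCube ν M → Fin d → ℝ) :=
      Set.univ.pi fun _ => Set.univ.pi fun _ => Set.Icc (-B) B
    have hK : IsCompact K := isCompact_univ_pi fun _ => isCompact_univ_pi fun _ => isCompact_Icc
    obtain ⟨δ, hδ, hGδ⟩ := hK.exists_delta_of_continuous hG (half_pos hε)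
    obtain ⟨n, W, h, A, hA⟩ := exists_shallow_network_approx hσc hσ
      (fun x : gridCube ν L × Fin d → ℝ => x) continuous_id B (half_pos hδ)
    -- The features of the first layer at a node, as a function of the window `γ + Z_L`.
    let feat : (gridCube ν L × Fin d → ℝ) → Fin n → ℝ := fun x i => σ (∑ p, W i p * x p + h i)
    have hfeat : Continuous feat := by fun_prop
    obtain ⟨B', hB'⟩ := (isCompact_univ_pi fun _ : gridCube ν L × Fin d =>
      isCompact_Icc (a := -B) (b := B)).exists_bound_of_continuousOn hfeat.continuousOn
    obtain ⟨net, hdepth, hnet⟩ := ih rfl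
      (fun y : gridCube ν ((m + 1) * L) → Fin n → ℝ =>
        G fun p k => ∑ i, A (off p, k) i * y (base p) i) (by fun_prop) (max B' 0) (half_pos hε)
    refine ⟨.conv (windowWeights W) h net,
      by rw [ConvLayers.hiddenDepth, hdepth], fun N Φ hΦ γ hγ j => ?_⟩
    set Φ₁ := convLayer σ L (N + net.hiddenDepth * L)
      (windowWeights W) h Φ with hΦ₁
    have hval : ∀ γ' ∈ gridCube ν (N + net.hiddenDepth * L),
        Φ₁ γ' = feat fun p => gridWindow L Φ γ' p.1 p.2 := fun γ' hγ' =>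
      funext fun i => convLayer_window W h Φ hγ' i
    have hbound : ∀ k i, |Φ₁ k i| ≤ max B' 0 := by
      intro k i
      by_cases hk : k ∈ gridCube ν (N + net.hiddenDepth * L)
      · rw [hval k hk]
        refine le_max_of_le_left ((norm_le_pi_norm (feat _) i).trans (hB' _ fun p _ => ?_))
        exact abs_le.1 (hΦ _ _)
      · simp [hΦ₁, convLayer, hk]
    have h1 := hnet N Φ₁ hbound γ hγ j
    -- By the choice of `A`, the argument on the right is `δ`-close to the window of `Φ`.
    have h2 : dist (G (gridWindow M Φ γ))
        (G fun p k => ∑ i, A (off p, k) i * gridWindow ((m + 1) * L) Φ₁ γ (base p) i) < ε / 2 := by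
      refine hGδ _ (fun p _ k _ => abs_le.1 (hΦ _ _)) _ (lt_of_le_of_lt ?_ (half_lt_self hδ))
      refine (dist_pi_le_iff (half_pos hδ).le).2 fun p => (dist_pi_le_iff (half_pos hδ).le).2
        fun k => ?_
      have h3 : γ + (base p).1 ∈ gridCube ν (N + net.hiddenDepth * L) := by
        rw [hdepth]
        exact add_mem_gridCube hγ (base p).2
      have h4 := hA (fun q => gridWindow L Φ (γ + (base p).1) q.1 q.2) (fun q => hΦ _ _) (off p, k)
      rw [dist_comm, Real.dist_eq]
      simp only [gridWindow] at h4 ⊢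
      rw [hval _ h3]
      simp only [feat, gridWindow]
      rw [add_assoc γ, hbo] at h4
      exact h4.le
    have h5 := (dist_le_pi_dist _ _ j).trans_lt h2
    rw [dist_comm, Real.dist_eq] at h5
    rw [ConvLayers.run, ← hΦ₁]
    calc _ ≤ _ := abs_sub_le _ _ _
      _ < ε / 2 + ε / 2 := add_lt_add h1 h5
      _ = ε := add_halves ε

end Grid

/-! ### Translations of `L²` signals -/

section Translation

variable {ν d : ℕ}

/-- The translation `R_γ` as a linear isometry. -/
def translateₗᵢ (γ : Fin ν → ℝ) : L2Signal ν d →ₗᵢ[ℝ] L2Signal ν d :=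
  Lp.compMeasurePreservingₗᵢ ℝ (fun θ => θ - γ) (measurePreserving_sub_right volume γ)

theorem translateₗᵢ_apply (γ : Fin ν → ℝ) (Φ : L2Signal ν d) :
    translateₗᵢ γ Φ = translateL2 γ Φ := rfl

theorem translateL2_translateL2 (γ γ' : Fin ν → ℝ) (Φ : L2Signal ν d) :
    translateL2 γ (translateL2 γ' Φ) = translateL2 (γ + γ') Φ := by
  unfold translateL2
  rw [← Lp.compMeasurePreserving_comp_apply]
  congr 2
  ext θ s
  simp [sub_sub]

theorem translateL2_zero (Φ : L2Signal ν d) : translateL2 0 Φ = Φ := by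
  unfold translateL2
  conv_rhs => rw [← Lp.compMeasurePreserving_id_apply Φ]
  congr 2
  ext θ s
  simp

theorem translateL2_neg_translateL2 (γ : Fin ν → ℝ) (Φ : L2Signal ν d) :
    translateL2 (-γ) (translateL2 γ Φ) = Φ := by
  rw [translateL2_translateL2, neg_add_cancel, translateL2_zero]

theorem translateL2_sub (γ : Fin ν → ℝ) (Φ Ψ : L2Signal ν d) :
    translateL2 γ (Φ - Ψ) = translateL2 γ Φ - translateL2 γ Ψ := map_sub (translateₗᵢ γ) Φ Ψ

theorem norm_translateL2 (γ : Fin ν → ℝ) (Φ : L2Signal ν d) : ‖translateL2 γ Φ‖ = ‖Φ‖ :=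
  (translateₗᵢ γ).norm_map Φ

theorem continuous_translateL2 (γ : Fin ν → ℝ) :
    Continuous (translateL2 γ : L2Signal ν d → L2Signal ν d) := (translateₗᵢ γ).continuous

theorem inner_translateL2_translateL2 (γ : Fin ν → ℝ) (Φ Ψ : L2Signal ν d) :
    inner ℝ (translateL2 γ Φ) (translateL2 γ Ψ) = inner ℝ Φ Ψ := (translateₗᵢ γ).inner_map_map Φ Ψ

theorem inner_translateL2_left (γ : Fin ν → ℝ) (Φ Ψ : L2Signal ν d) :
    inner ℝ (translateL2 γ Φ) Ψ = inner ℝ Φ (translateL2 (-γ) Ψ) := by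
  rw [← inner_translateL2_translateL2 (-γ), translateL2_neg_translateL2]

/-- Translations act strongly continuously. -/
theorem continuous_translateL2_left (Φ : L2Signal ν d) :
    Continuous fun γ : Fin ν → ℝ => translateL2 γ Φ := by
  let g : (Fin ν → ℝ) → C(Fin ν → ℝ, Fin ν → ℝ) := fun γ => ⟨fun θ => θ - γ, by fun_prop⟩
  have hg : Continuous g := by
    refine ContinuousMap.continuous_of_continuous_uncurry _ ?_
    simp only [Function.uncurry_def, g, ContinuousMap.coe_mk]
    fun_prop
  exact (continuous_const (y := Φ)).compMeasurePreservingLp hg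
    (fun γ => measurePreserving_sub_right volume γ) (by simp)

end Translation

/-! ### Cells, averages and projections -/

section Cells

variable {ν d : ℕ} {lam : ℝ}

/-- The signal with value `v` on the cell `Q_k` and `0` elsewhere. -/
def cellIndicator (lam : ℝ) (k : Fin ν → ℤ) (v : EuclideanSpace ℝ (Fin d)) : L2Signal ν d :=
  indicatorConstLp 2 (measurableSet_gridCell lam k) (volume_gridCell_ne_top lam k) v

theorem mem_gridCell {k : Fin ν → ℤ} {θ : Fin ν → ℝ} :
    θ ∈ gridCell lam k ↔
      ∀ s, ((k s : ℝ) - 1 / 2) * lam ≤ θ s ∧ θ s < ((k s : ℝ) + 1 / 2) * lam := by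
  simp [gridCell]

theorem mem_gridCell_iff_floor (hlam : 0 < lam) {k : Fin ν → ℤ} {θ : Fin ν → ℝ} :
    θ ∈ gridCell lam k ↔ ∀ s, ⌊θ s / lam + 1 / 2⌋ = k s := by
  rw [mem_gridCell]
  refine forall_congr' fun s => ?_
  rw [Int.floor_eq_iff, ← sub_le_iff_le_add, le_div_iff₀ hlam, ← lt_sub_iff_add_lt,
    div_lt_iff₀ hlam]
  ring_nf

theorem disjoint_gridCell (hlam : 0 < lam) {j k : Fin ν → ℤ} (h : j ≠ k) :
    Disjoint (gridCell lam j) (gridCell lam k) := by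
  rw [Set.disjoint_left]
  intro θ hj hk
  rw [mem_gridCell_iff_floor hlam] at hj hk
  exact h (funext fun s => (hj s).symm.trans (hk s))

theorem volume_real_gridCell (hlam : 0 < lam) (k : Fin ν → ℤ) :
    volume.real (gridCell lam k) = lam ^ ν := by
  rw [gridCell, measureReal_def, volume_pi_pi, ENNReal.toReal_prod]
  have : ∀ s, (volume (Set.Ico (((k s : ℝ) - 1 / 2) * lam) (((k s : ℝ) + 1 / 2) * lam))).toReal
      = lam := by
    intro s
    rw [Real.volume_Ico, ENNReal.toReal_ofReal] <;> ring_nf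
    exact hlam.le
  rw [Finset.prod_congr rfl fun s _ => this s, Finset.prod_const, Finset.card_univ,
    Fintype.card_fin]

/-- The node `lam * m`. -/
def gridNode (lam : ℝ) (m : Fin ν → ℤ) : Fin ν → ℝ := fun s => m s * lam

theorem gridNode_neg (m : Fin ν → ℤ) : gridNode lam (-m) = -gridNode lam m := by
  ext s
  simp [gridNode]

theorem indicatorConstLp_congr {s t : Set (Fin ν → ℝ)} (h : s = t) (hs : MeasurableSet s)
    (hs' : volume s ≠ ⊤) (ht : MeasurableSet t) (ht' : volume t ≠ ⊤)
    (v : EuclideanSpace ℝ (Fin d)) :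
    indicatorConstLp 2 hs hs' v = indicatorConstLp 2 ht ht' v := by
  subst h
  rfl

theorem translateL2_cellIndicator (k m : Fin ν → ℤ) (v : EuclideanSpace ℝ (Fin d)) :
    translateL2 (gridNode lam m) (cellIndicator lam k v) = cellIndicator lam (k + m) v := by
  rw [translateL2, cellIndicator, Lp.indicatorConstLp_compMeasurePreserving]
  refine indicatorConstLp_congr ?_ _ _ _ _ v
  ext θ
  simp only [Set.mem_preimage, mem_gridCell, gridNode, Pi.sub_apply, Pi.add_apply, Int.cast_add]
  refine forall_congr' fun s => ?_
  constructor <;> rintro ⟨h1, h2⟩ <;> constructor <;> linarith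

theorem continuous_cellIndicator (k : Fin ν → ℤ) :
    Continuous (cellIndicator lam k : EuclideanSpace ℝ (Fin d) → L2Signal ν d) := by
  refine (LipschitzWith.of_dist_le_mul 
    (K := (volume.real (gridCell lam k) ^ (1 / (2 : ENNReal).toReal)).toNNReal)
    fun v w => ?_).continuous
  rw [dist_eq_norm, dist_eq_norm, cellIndicator, cellIndicator, indicatorConstLp_sub,
    Real.coe_toNNReal _ (by positivity), mul_comm]
  exact norm_indicatorConstLp_le

theorem inner_cellIndicator_cellIndicator (hlam : 0 < lam) (j k : Fin ν → ℤ)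
    (v w : EuclideanSpace ℝ (Fin d)) :
    inner ℝ (cellIndicator lam j v) (cellIndicator lam k w)
      = if j = k then lam ^ ν * inner ℝ v w else 0 := by
  rw [cellIndicator, cellIndicator, L2.inner_indicatorConstLp_indicatorConstLp _ _
    (volume_gridCell_ne_top lam j) (volume_gridCell_ne_top lam k)]
  split_ifs with h
  · subst h
    rw [Set.inter_self, volume_real_gridCell hlam, smul_eq_mul]
  · rw [(disjoint_gridCell hlam h).inter_eq, measureReal_empty, zero_smul]

/-- The average of a signal over the cell `Q_k`, in coordinates. -/
def cellAverage (lam : ℝ) (k : Fin ν → ℤ) (Φ : L2Signal ν d) : Fin d → ℝ :=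
  fun n => ((lam ^ ν)⁻¹ • ∫ θ in gridCell lam k, Φ θ) n

theorem inner_cellIndicator (hlam : 0 < lam) (k : Fin ν → ℤ) (v : EuclideanSpace ℝ (Fin d))
    (Φ : L2Signal ν d) :
    inner ℝ (cellIndicator lam k v) Φ
      = lam ^ ν * inner ℝ v (WithLp.toLp 2 (cellAverage lam k Φ)) := by
  have h : WithLp.toLp 2 (cellAverage lam k Φ) = (lam ^ ν)⁻¹ • ∫ θ in gridCell lam k, Φ θ := rfl
  have : lam ^ ν ≠ 0 := by positivity
  rw [cellIndicator, L2.inner_indicatorConstLp_eq_inner_setIntegral, h, inner_smul_right]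
  field_simp

theorem cellAverage_apply (hlam : 0 < lam) (k : Fin ν → ℤ) (Φ : L2Signal ν d) (n : Fin d) :
    cellAverage lam k Φ n
      = (lam ^ ν)⁻¹ * inner ℝ (cellIndicator lam k (EuclideanSpace.single n 1)) Φ := by
  have : lam ^ ν ≠ 0 := by positivity
  rw [inner_cellIndicator hlam, EuclideanSpace.inner_single_left]
  field_simp
  simp

theorem continuous_cellAverage (hlam : 0 < lam) (k : Fin ν → ℤ) :
    Continuous (cellAverage lam k : L2Signal ν d → Fin d → ℝ) := by
  refine continuous_pi fun n => ?_
  simp only [cellAverage_apply hlam]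
  fun_prop

theorem cellAverage_translateL2 (hlam : 0 < lam) (k m : Fin ν → ℤ) (Φ : L2Signal ν d) :
    cellAverage lam k (translateL2 (-gridNode lam m) Φ) = cellAverage lam (k + m) Φ := by
  ext n
  rw [cellAverage_apply hlam, cellAverage_apply hlam, ← inner_translateL2_left,
    translateL2_cellIndicator]

theorem discretize_apply (N : ℕ) (Φ : L2Signal ν d) (k : Fin ν → ℤ) :
    discretize lam N Φ k = if k ∈ gridCube ν N then cellAverage lam k Φ else 0 := by
  ext n
  simp only [discretize]
  split_ifs <;> rfl

theorem continuous_discretize (hlam : 0 < lam) (N : ℕ) :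
    Continuous (discretize lam N : L2Signal ν d → GridSignal ν d) := by
  refine continuous_pi fun k => ?_
  simp only [discretize_apply]
  split_ifs
  · exact continuous_cellAverage hlam k
  · exact continuous_const

theorem gridToL2_eq_sum (N : ℕ) (Φ : GridSignal ν d) :
    gridToL2 lam N Φ = ∑ k ∈ gridCube ν N, cellIndicator lam k (WithLp.toLp 2 (Φ k)) := rfl

theorem continuous_gridToL2 (N : ℕ) :
    Continuous (gridToL2 lam N : GridSignal ν d → L2Signal ν d) := by
  change Continuous fun Φ : GridSignal ν d =>
    ∑ k ∈ gridCube ν N, cellIndicator lam k (WithLp.toLp 2 (Φ k))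
  refine continuous_finsetSum _ fun k _ => (continuous_cellIndicator k).comp ?_
  exact (PiLp.continuous_toLp 2 _).comp (continuous_apply k)

theorem continuous_basicConvnet {dU : ℕ} {σ : ℝ → ℝ} (hσ : Continuous σ) (L : ℕ) (hlam : 0 < lam)
    (Lam : ℝ) (net : ConvLayers ν d dU) : Continuous (basicConvnet σ L lam Lam net) :=
  (continuous_gridToL2 _).comp ((net.continuous_run hσ _ _).comp (continuous_discretize hlam _))

/-- The signals that are constant on the cells `Q_k`, `k ∈ Z_N`, and vanish outside them. -/
def gridSpace (ν d : ℕ) (lam : ℝ) (N : ℕ) : Submodule ℝ (L2Signal ν d) :=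
  Submodule.span ℝ {Ψ | ∃ k ∈ gridCube ν N, ∃ v, Ψ = cellIndicator lam k v}

theorem cellIndicator_mem_gridSpace {N : ℕ} {k : Fin ν → ℤ} (hk : k ∈ gridCube ν N)
    (v : EuclideanSpace ℝ (Fin d)) : cellIndicator lam k v ∈ gridSpace ν d lam N :=
  Submodule.subset_span ⟨k, hk, v, rfl⟩

theorem gridToL2_mem_gridSpace (N : ℕ) (Φ : GridSignal ν d) :
    gridToL2 lam N Φ ∈ gridSpace ν d lam N :=
  Submodule.sum_mem _ fun _ hk => cellIndicator_mem_gridSpace hk _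

theorem monotone_gridSpace : Monotone (gridSpace ν d lam) := by
  intro M N h
  refine Submodule.span_mono ?_
  rintro _ ⟨k, hk, v, rfl⟩
  exact ⟨k, gridCube_mono h hk, v, rfl⟩

theorem inner_sub_gridToL2_discretize (hlam : 0 < lam) (N : ℕ) (Φ w : L2Signal ν d)
    (hw : w ∈ gridSpace ν d lam N) :
    inner ℝ (Φ - gridToL2 lam N (discretize lam N Φ)) w = 0 := by
  refine Submodule.span_induction ?_ (inner_zero_right _) ?_ ?_ hw
  · rintro _ ⟨k, hk, v, rfl⟩
    rw [real_inner_comm, inner_sub_right, gridToL2_eq_sum, inner_sum, inner_cellIndicator hlam]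
    simp only [inner_cellIndicator_cellIndicator hlam]
    rw [Finset.sum_ite_eq, if_pos hk, discretize_apply, if_pos hk, sub_self]
  · intro x y _ _ hx hy
    rw [inner_add_right, hx, hy, add_zero]
  · intro a x _ hx
    rw [inner_smul_right, hx, mul_zero]

instance [Fact (0 < lam)] (N : ℕ) : (gridSpace ν d lam N).HasOrthogonalProjection where
  exists_orthogonal Φ := ⟨gridToL2 lam N (discretize lam N Φ), gridToL2_mem_gridSpace _ _, by
    rw [Submodule.mem_orthogonal']
    exact fun w hw => inner_sub_gridToL2_discretize Fact.out N Φ w hw⟩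

/-- Averaging over the cells is the orthogonal projection to the grid signals. -/
theorem starProjection_gridSpace [hlam : Fact (0 < lam)] (N : ℕ) (Φ : L2Signal ν d) :
    (gridSpace ν d lam N).starProjection Φ = gridToL2 lam N (discretize lam N Φ) :=
  Submodule.eq_starProjection_of_mem_of_inner_eq_zero (gridToL2_mem_gridSpace _ _)
    fun w hw => inner_sub_gridToL2_discretize hlam.out N Φ w hw

/-- The signals that are constant on all cells of the infinite grid. -/
def gridSpaceTop (ν d : ℕ) (lam : ℝ) : Submodule ℝ (L2Signal ν d) :=
  (⨆ N, gridSpace ν d lam N).topologicalClosure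

instance : CompleteSpace (gridSpaceTop ν d lam) :=
  inferInstanceAs (CompleteSpace (⨆ N, gridSpace ν d lam N).topologicalClosure)

theorem gridSpace_le_gridSpaceTop (N : ℕ) : gridSpace ν d lam N ≤ gridSpaceTop ν d lam :=
  (le_iSup _ N).trans (Submodule.le_topologicalClosure _)

theorem exists_mem_gridCube (m : Fin ν → ℤ) : ∃ N, m ∈ gridCube ν N := by
  refine ⟨Finset.univ.sup fun s => (m s).natAbs, ?_⟩
  rw [mem_gridCube]
  intro s
  rw [Int.abs_eq_natAbs]
  exact_mod_cast Finset.le_sup (f := fun s => (m s).natAbs) (Finset.mem_univ s)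

theorem translateL2_mem_gridSpaceTop (m : Fin ν → ℤ) {w : L2Signal ν d}
    (hw : w ∈ gridSpaceTop ν d lam) : translateL2 (gridNode lam m) w ∈ gridSpaceTop ν d lam := by
  have h : (⨆ N, gridSpace ν d lam N) ≤
      (gridSpaceTop ν d lam).comap (translateₗᵢ (gridNode lam m)).toLinearMap := by
    refine iSup_le fun N => Submodule.span_le.2 ?_
    rintro _ ⟨k, hk, v, rfl⟩
    obtain ⟨M, hM⟩ := exists_mem_gridCube m
    refine gridSpace_le_gridSpaceTop (N + M) ?_
    change translateL2 (gridNode lam m) (cellIndicator lam k v) ∈ _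
    rw [translateL2_cellIndicator]
    exact cellIndicator_mem_gridSpace (add_mem_gridCube hk hM) v
  exact closure_minimal h ((Submodule.isClosed_topologicalClosure _).preimage
    (continuous_translateL2 (gridNode lam m))) hw

/-- The projection to the signals on the infinite grid commutes with translations by grid
vectors; the projections to finite grids do not. -/
theorem starProjection_gridSpaceTop_translateL2 (m : Fin ν → ℤ) (Φ : L2Signal ν d) :
    (gridSpaceTop ν d lam).starProjection (translateL2 (gridNode lam m) Φ)
      = translateL2 (gridNode lam m) ((gridSpaceTop ν d lam).starProjection Φ) := by
  refine Submodule.eq_starProjection_of_mem_of_inner_eq_zero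
    (translateL2_mem_gridSpaceTop m (Submodule.starProjection_apply_mem _ _)) fun w hw => ?_
  rw [← translateL2_sub, inner_translateL2_left, ← gridNode_neg]
  exact Submodule.starProjection_inner_eq_zero _ _ (translateL2_mem_gridSpaceTop (-m) hw)

open Filter Topology in
theorem tendsto_starProjection_gridSpace [Fact (0 < lam)] (Φ : L2Signal ν d) :
    Tendsto (fun N => (gridSpace ν d lam N).starProjection Φ) atTop
      (𝓝 ((gridSpaceTop ν d lam).starProjection Φ)) := by
  exact Submodule.starProjection_tendsto_closure_iSup _ monotone_gridSpace Φ

end Cells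

/-! ### Density of the grid signals -/

section Approximation

variable {ν d : ℕ}

theorem gridToL2_coeFn {lam : ℝ} (N : ℕ) (Φ : GridSignal ν d) :
    ∀ᵐ θ, (gridToL2 lam N Φ : (Fin ν → ℝ) → EuclideanSpace ℝ (Fin d)) θ =
      ∑ k ∈ gridCube ν N, (gridCell lam k).indicator (fun _ => WithLp.toLp 2 (Φ k)) θ := by
  have h1 := Lp.coeFn_finsetSum (gridCube ν N)
    fun k => cellIndicator lam k (WithLp.toLp 2 (Φ k))
  have h2 : ∀ᵐ θ : Fin ν → ℝ, ∀ k : Fin ν → ℤ,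
      (cellIndicator lam k (WithLp.toLp 2 (Φ k)) : (Fin ν → ℝ) → EuclideanSpace ℝ (Fin d)) θ
        = (gridCell lam k).indicator (fun _ => WithLp.toLp 2 (Φ k)) θ :=
    ae_all_iff.2 fun k => indicatorConstLp_coeFn
  filter_upwards [h1, h2] with θ h1 h2
  rw [gridToL2_eq_sum, h1, Finset.sum_apply]
  exact Finset.sum_congr rfl fun k _ => h2 k

/-- At each point only the cell that contains it contributes. -/
theorem sum_indicator_gridCell {lam : ℝ} (hlam : 0 < lam) (N : ℕ)
    (c : (Fin ν → ℤ) → EuclideanSpace ℝ (Fin d)) {k : Fin ν → ℤ} {θ : Fin ν → ℝ}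
    (hθ : θ ∈ gridCell lam k) :
    ∑ j ∈ gridCube ν N, (gridCell lam j).indicator (fun _ => c j) θ
      = if k ∈ gridCube ν N then c k else 0 := by
  classical
  rw [← Finset.sum_ite_eq' (gridCube ν N) k c]
  refine Finset.sum_congr rfl fun j _ => ?_
  split_ifs with h
  · rw [h, Set.indicator_of_mem hθ]
  · exact Set.indicator_of_notMem (fun hj => Set.disjoint_left.1 (disjoint_gridCell hlam h) hj hθ) _

/-- Sampling a continuous function with compact support at the nodes shows that every `L²` signal
is approximated by grid signals once the spacing is small and the grid is large. -/
theorem exists_mem_gridSpace_norm_sub_lt (Φ : L2Signal ν d) {ε : ℝ} (hε : 0 < ε) :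
    ∃ R > 0, ∃ δ > 0, ∀ lam : ℝ, 0 < lam → lam ≤ δ → ∀ N : ℕ, R ≤ N * lam →
      ∃ w ∈ gridSpace ν d lam N, ‖Φ - w‖ < ε := by
  obtain ⟨g, hgc, hgε, hgcont, hgmem⟩ := (Lp.memLp Φ).exists_hasCompactSupport_eLpNorm_sub_le
    (by simp) (ε := ENNReal.ofReal (ε / 4)) (by simpa using hε)
  obtain ⟨R₀, hR₀pos, hR₀⟩ := hgc.isCompact.isBounded.exists_pos_norm_le
  have hg0 : ∀ θ, R₀ < ‖θ‖ → g θ = 0 := by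
    intro θ hθ
    by_contra h
    exact absurd (hR₀ θ (subset_tsupport g h)) (not_le.2 hθ)
  let S : Set (Fin ν → ℝ) := Metric.closedBall 0 (R₀ + 1)
  have hS : MeasurableSet S := measurableSet_closedBall
  have hS' : volume S ≠ ⊤ := measure_closedBall_lt_top.ne
  let V : ℝ := volume.real S ^ (1 / (2 : ENNReal).toReal)
  have hV : 0 ≤ V := by positivity
  let η : ℝ := ε / (4 * (V + 1))
  have hη : 0 < η := by positivity
  have hηV : η * V ≤ ε / 4 := by
    have : η * (V + 1) = ε / 4 := by
      simp only [η]
      field_simp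
    nlinarith
  obtain ⟨δ₀, hδ₀, hgδ⟩ := Metric.uniformContinuous_iff.1
    (hgc.uniformContinuous_of_continuous hgcont) η hη
  refine ⟨R₀ + 1, by positivity, min δ₀ 1, by positivity, fun lam hlam hlamδ N hN =>
    ⟨gridToL2 lam N fun k => (g (gridNode lam k)).ofLp, gridToL2_mem_gridSpace _ _, ?_⟩⟩
  set w : L2Signal ν d := gridToL2 lam N fun k => (g (gridNode lam k)).ofLp with hw
  have h1 : ‖Φ - hgmem.toLp g‖ ≤ ε / 4 := by
    rw [Lp.norm_def]
    refine ENNReal.toReal_le_of_le_ofReal (by positivity) (le_trans (le_of_eq ?_) hgε)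
    refine eLpNorm_congr_ae ?_
    filter_upwards [Lp.coeFn_sub Φ (hgmem.toLp g), hgmem.coeFn_toLp] with θ h2 h3
    rw [h2, Pi.sub_apply, Pi.sub_apply, h3]
  have h2 : ‖hgmem.toLp g - w‖ ≤ ‖indicatorConstLp 2 hS hS' η‖ := by
    refine Lp.norm_le_norm_of_ae_le ?_
    filter_upwards [Lp.coeFn_sub (hgmem.toLp g) w, hgmem.coeFn_toLp,
      gridToL2_coeFn (lam := lam) N fun k => (g (gridNode lam k)).ofLp,
      indicatorConstLp_coeFn (p := 2) (hs := hS) (hμs := hS') (c := η)] with θ h3 h4 h5 h6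
    let k : Fin ν → ℤ := fun s => ⌊θ s / lam + 1 / 2⌋
    have hθ : θ ∈ gridCell lam k := (mem_gridCell_iff_floor hlam).2 fun s => rfl
    have hθ' := mem_gridCell.1 hθ
    have hdist : ‖gridNode lam k - θ‖ ≤ lam / 2 := by
      refine (pi_norm_le_iff_of_nonneg (by positivity)).2 fun s => ?_
      have := hθ' s
      rw [Pi.sub_apply, Real.norm_eq_abs, abs_le]
      simp only [gridNode]
      constructor <;> linarith [this.1, this.2]
    rw [h3, Pi.sub_apply, h4, hw, h5, sum_indicator_gridCell hlam N _ hθ, h6]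
    by_cases hk : k ∈ gridCube ν N
    · rw [if_pos hk]
      by_cases hθS : θ ∈ S
      · rw [Set.indicator_of_mem hθS, ← dist_eq_norm, Real.norm_of_nonneg hη.le]
        refine (hgδ ?_).le
        rw [dist_comm, dist_eq_norm]
        linarith [min_le_left δ₀ 1]
      · have hθn : R₀ + 1 < ‖θ‖ := by simpa [S] using hθS
        rw [hg0 θ (by linarith), hg0 (gridNode lam k)]
        · simp
        · have := norm_sub_norm_le θ (gridNode lam k)
          rw [norm_sub_rev] at this
          linarith [min_le_right δ₀ 1]
    -- Outside the grid `θ` is far from the origin, and both functions vanish.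
    · rw [if_neg hk, hg0 θ]
      · simp
      · rw [mem_gridCube] at hk
        push Not at hk
        obtain ⟨s, hs⟩ := hk
        have h7 : (N : ℝ) + 1 ≤ |(k s : ℝ)| := by exact_mod_cast hs
        have h8 : |gridNode lam k s| ≤ |gridNode lam k s - θ s| + |θ s| := by
          simpa using abs_add_le (gridNode lam k s - θ s) (θ s)
        have h9 := (norm_le_pi_norm (gridNode lam k - θ) s).trans hdist
        have h10 := norm_le_pi_norm θ s
        rw [Real.norm_eq_abs] at h9 h10
        have h11 : |gridNode lam k s| = |(k s : ℝ)| * lam := by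
          rw [gridNode, abs_mul, abs_of_pos hlam]
        rw [Pi.sub_apply] at h9
        nlinarith
  have h3 : ‖indicatorConstLp 2 hS hS' η‖ ≤ ‖η‖ * V := norm_indicatorConstLp_le
  rw [Real.norm_of_nonneg hη.le] at h3
  have := norm_sub_le_norm_sub_add_norm_sub Φ (hgmem.toLp g) w
  linarith

theorem norm_sub_starProjection_le {E : Type*} [NormedAddCommGroup E] [InnerProductSpace ℝ E]
    (W : Submodule ℝ E) [W.HasOrthogonalProjection] (x : E) {w : E} (hw : w ∈ W) :
    ‖x - W.starProjection x‖ ≤ ‖x - w‖ := by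
  rw [Submodule.starProjection_minimal]
  exact ciInf_le ⟨0, by rintro _ ⟨y, rfl⟩; exact norm_nonneg _⟩ (⟨w, hw⟩ : W)

/-- The projections to the grid signals converge to the identity uniformly on compact sets. -/
theorem IsCompact.exists_norm_sub_starProjection_gridSpace_lt {K : Set (L2Signal ν d)}
    (hK : IsCompact K) {ε : ℝ} (hε : 0 < ε) :
    ∃ R > 0, ∃ δ > 0, ∀ lam : ℝ, lam ≤ δ → ∀ [Fact (0 < lam)], ∀ N : ℕ, R ≤ N * lam →
      ∀ Φ ∈ K, ‖Φ - (gridSpace ν d lam N).starProjection Φ‖ < ε := by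
  obtain ⟨t, -, htf, htK⟩ := hK.finite_cover_balls (half_pos hε)
  have hex := fun Φ : L2Signal ν d => exists_mem_gridSpace_norm_sub_lt Φ (half_pos hε)
  choose R hR δ hδ happ using hex
  obtain ⟨R', hR'⟩ := (htf.image R).bddAbove
  obtain ⟨δ', hδ'pos, hδ'⟩ : ∃ δ' > 0, ∀ Φ ∈ t, δ' ≤ δ Φ := by
    rcases htf.toFinset.eq_empty_or_nonempty with h | h
    · refine ⟨1, one_pos, fun Φ hΦ => ?_⟩
      simp only [Set.Finite.toFinset_eq_empty] at h
      simp [h] at hΦ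
    · refine ⟨htf.toFinset.inf' h δ, (Finset.lt_inf'_iff h).2 fun Φ _ => hδ Φ, fun Φ hΦ =>
        Finset.inf'_le _ (htf.mem_toFinset.2 hΦ)⟩
  refine ⟨max R' 1, by positivity, δ', hδ'pos, fun lam hlam _ N hN Φ hΦ => ?_⟩
  obtain ⟨Ψ, hΨt, hΨ⟩ := Set.mem_iUnion₂.1 (htK hΦ)
  obtain ⟨w, hw, hwn⟩ := happ Ψ lam Fact.out (hlam.trans (hδ' Ψ hΨt)) N
    ((hR' ⟨Ψ, hΨt, rfl⟩).trans ((le_max_left _ _).trans hN))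
  refine (norm_sub_starProjection_le _ Φ hw).trans_lt ?_
  have := norm_sub_le_norm_sub_add_norm_sub Φ Ψ w
  rw [Metric.mem_ball, dist_eq_norm] at hΨ
  linarith

end Approximation

/-! ### Continuous equivariant maps are limit points -/

section Sufficiency

variable {ν d : ℕ} {lam : ℝ}

/-- Extension by zero of the values on `Z_N` to a grid signal. -/
def extendZero {N : ℕ} (x : gridCube ν N → Fin d → ℝ) : GridSignal ν d :=
  fun k => if hk : k ∈ gridCube ν N then x ⟨k, hk⟩ else 0

theorem continuous_extendZero {N : ℕ} :
    Continuous (extendZero : (gridCube ν N → Fin d → ℝ) → GridSignal ν d) := by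
  refine continuous_pi fun k => ?_
  unfold extendZero
  split_ifs
  · exact continuous_apply _
  · exact continuous_const

theorem gridToL2_congr {N : ℕ} {Φ Ψ : GridSignal ν d} (h : ∀ k ∈ gridCube ν N, Φ k = Ψ k) :
    gridToL2 lam N Φ = gridToL2 lam N Ψ := by
  rw [gridToL2_eq_sum, gridToL2_eq_sum]
  exact Finset.sum_congr rfl fun k hk => by rw [h k hk]

theorem gridToL2_extendZero {N : ℕ} {x : gridCube ν N → Fin d → ℝ} {Φ : GridSignal ν d}
    (h : ∀ k : gridCube ν N, x k = Φ k) :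
    gridToL2 lam N (extendZero x) = gridToL2 lam N Φ :=
  gridToL2_congr fun k hk => by rw [extendZero, dif_pos hk, h]

open Filter Topology in
/-- Pointwise convergence of nonexpansive maps is uniform on compact sets. -/
theorem IsCompact.exists_forall_norm_sub_lt {E : Type*} [SeminormedAddCommGroup E] {P : ℕ → E → E}
    {Q : E → E} (hP : ∀ n, LipschitzWith 1 (P n)) (hQ : LipschitzWith 1 Q)
    (h : ∀ x, Tendsto (fun n => P n x) atTop (𝓝 (Q x))) {K : Set E} (hK : IsCompact K) {ε : ℝ}
    (hε : 0 < ε) : ∃ n₀, ∀ n ≥ n₀, ∀ x ∈ K, dist (Q x) (P n x) < ε := by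
  have hε3 : 0 < ε / 3 := by positivity
  obtain ⟨t, -, htf, htK⟩ := hK.finite_cover_balls hε3
  have hev : ∀ᶠ n in atTop, ∀ y ∈ t, dist (P n y) (Q y) < ε / 3 :=
    htf.eventually_all.2 fun y _ => (Metric.tendsto_nhds.1 (h y)) _ hε3
  obtain ⟨n₀, hn₀⟩ := eventually_atTop.1 hev
  refine ⟨n₀, fun n hn x hx => ?_⟩
  obtain ⟨y, hyt, hy⟩ := Set.mem_iUnion₂.1 (htK hx)
  rw [Metric.mem_ball] at hy
  have h1 := (hP n).dist_le_mul x y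
  have h2 := hQ.dist_le_mul x y
  have h3 := hn₀ n hn y hyt
  have h4 := dist_triangle4 (Q x) (Q y) (P n y) (P n x)
  rw [dist_comm (Q y), dist_comm (P n y) (P n x)] at h4
  simp only [NNReal.coe_one, one_mul] at h1 h2
  linarith

/-- For a fixed grid, a convnet computes at each node `k ∈ Z_N`, up to a small error, a given
continuous functional of the signal seen from that node. -/
theorem exists_convLayers_approx_functional {σ : ℝ → ℝ} (hσc : Continuous σ)
    (hσ : ¬ ∃ p : Polynomial ℝ, ∀ x : ℝ, σ x = p.eval x) {L e : ℕ} (hL : 0 < L)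
    [hlam : Fact (0 < lam)] (N : ℕ) {φ : L2Signal ν d → Fin e → ℝ} (hφ : Continuous φ)
    {K : Set (L2Signal ν d)} (hK : IsCompact K) {η : ℝ} (hη : 0 < η) :
    ∃ net : ConvLayers ν d e, ∀ Φ ∈ K, ∀ k ∈ gridCube ν N, ∀ n,
      |net.run σ L N (discretize lam (N + net.hiddenDepth * L) Φ) k n
        - φ ((gridSpaceTop ν d lam).starProjection (translateL2 (-gridNode lam k) Φ)) n| < η := by
  let K' : Set (L2Signal ν d) := ⋃ k ∈ gridCube ν N, translateL2 (-gridNode lam k) '' K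
  have hK' : IsCompact K' := (gridCube ν N).isCompact_biUnion fun k _ =>
    hK.image (continuous_translateL2 _)
  obtain ⟨δ, hδ, hφδ⟩ := (hK'.image
    (gridSpaceTop ν d lam).starProjection.continuous).exists_delta_of_continuous hφ (half_pos hη)
  obtain ⟨m, hm⟩ := hK'.exists_forall_norm_sub_lt
    (fun M => (gridSpace ν d lam M).lipschitzWith_starProjection)
    (gridSpaceTop ν d lam).lipschitzWith_starProjection tendsto_starProjection_gridSpace hδ
  let M : ℕ := (m + 1) * L
  have hmM : m ≤ M := by
    have : (m + 1) * 1 ≤ (m + 1) * L := Nat.mul_le_mul_left _ hL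
    omega
  have hcont : Continuous fun (Φ : L2Signal ν d) (k : gridCube ν (N + M)) => cellAverage lam k Φ :=
    continuous_pi fun k => continuous_cellAverage hlam.out _
  obtain ⟨B, hB⟩ := hK.exists_bound_of_continuousOn hcont.continuousOn
  obtain ⟨net, hdepth, hnet⟩ := exists_convLayers_approx hσc hσ L e m (M := M) rfl
    (fun x : gridCube ν M → Fin d → ℝ => φ (gridToL2 lam M (extendZero x)))
    (hφ.comp ((continuous_gridToL2 M).comp continuous_extendZero)) (max B 0) (half_pos hη)
  refine ⟨net, fun Φ hΦ k hk n => ?_⟩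
  rw [hdepth]
  change |net.run σ L N (discretize lam (N + M) Φ) k n - _| < η
  have hbound : ∀ j n, |discretize lam (N + M) Φ j n| ≤ max B 0 := by
    intro j n
    rw [discretize_apply]
    split_ifs with hj
    · refine le_max_of_le_left (le_trans ?_ (hB Φ hΦ))
      exact (norm_le_pi_norm (cellAverage lam j Φ) n).trans (norm_le_pi_norm
        (fun k : gridCube ν (N + M) => cellAverage lam k.1 Φ) ⟨j, hj⟩)
    · simp
  have h1 := hnet N _ hbound k hk n
  have hwin : gridToL2 lam M (extendZero (gridWindow M (discretize lam (N + M) Φ) k))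
      = (gridSpace ν d lam M).starProjection (translateL2 (-gridNode lam k) Φ) := by
    rw [starProjection_gridSpace]
    refine gridToL2_extendZero fun j => ?_
    rw [gridWindow, discretize_apply, discretize_apply, if_pos j.2,
      if_pos (add_mem_gridCube hk j.2), cellAverage_translateL2 hlam.out, add_comm]
  rw [hwin] at h1
  have hmem : translateL2 (-gridNode lam k) Φ ∈ K' := Set.mem_iUnion₂.2 ⟨k, hk, Φ, hΦ, rfl⟩
  have h2 := (dist_le_pi_dist _ _ n).trans_lt
    (hφδ _ ⟨_, hmem, rfl⟩ _ (hm M hmM _ hmem))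
  rw [dist_comm, Real.dist_eq] at h2
  calc _ ≤ _ := abs_sub_le _ _ _
    _ < η / 2 + η / 2 := add_lt_add h1 h2
    _ = η := add_halves η

/-- Continuous equivariant maps are limit points. The error is split along
`f Φ`, `P_N (f Φ)`, `P_N (f (P Φ))` and the output of the convnet, with `P` the projection to the
infinite grid; the convnet is chosen after the spacing and the range. -/
theorem isLimitPointOfBasicConvnets_of_continuous {dU : ℕ} {σ : ℝ → ℝ} (hσc : Continuous σ)
    (hσ : ¬ ∃ p : Polynomial ℝ, ∀ x : ℝ, σ x = p.eval x) {f : L2Signal ν d → L2Signal ν dU}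
    (hfe : IsTranslationEquivariant f) (hf : Continuous f) :
    IsLimitPointOfBasicConvnets σ f := by
  intro L hL K hK ε lam₀ Lam₀ hε hlam₀ hLam₀
  have hε4 : 0 < ε / 4 := by positivity
  obtain ⟨R₁, hR₁, δ₁, hδ₁, happ₁⟩ :=
    (hK.image hf).exists_norm_sub_starProjection_gridSpace_lt hε4
  obtain ⟨δ, hδ, hfδ⟩ := hK.exists_delta_of_continuous hf hε4
  obtain ⟨R₂, hR₂, δ₂, hδ₂, happ₂⟩ := hK.exists_norm_sub_starProjection_gridSpace_lt hδ
  let Lam : ℝ := max Lam₀ (R₁ + 1)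
  let lam : ℝ := min (min lam₀ 1) (min δ₁ δ₂)
  have hlam : 0 < lam := by positivity
  have hlam1 : lam ≤ 1 := (min_le_left _ _).trans (min_le_right _ _)
  have : Fact (0 < lam) := ⟨hlam⟩
  set N : ℕ := ⌊Lam / lam⌋₊ with hN
  -- Rounding loses at most `lam ≤ 1`, whence the `1` in the definition of `Lam`.
  have hNlam : R₁ ≤ N * lam := by
    have h1 : Lam / lam < N + 1 := Nat.lt_floor_add_one _
    rw [div_lt_iff₀ hlam] at h1
    have h2 : R₁ + 1 ≤ Lam := le_max_right _ _
    linarith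
  let P := (gridSpaceTop ν d lam).starProjection
  have hP : ∀ Φ ∈ K, dist Φ (P Φ) < δ := by
    intro Φ hΦ
    obtain ⟨N₂, hN₂⟩ := exists_nat_ge (R₂ / lam)
    rw [div_le_iff₀ hlam] at hN₂
    rw [dist_eq_norm]
    refine (norm_sub_starProjection_le _ _ (gridSpace_le_gridSpaceTop N₂
      (Submodule.starProjection_apply_mem _ Φ))).trans_lt
      (happ₂ lam ((min_le_right _ _).trans (min_le_right _ _)) N₂ hN₂ Φ hΦ)
  -- The ideal network: its value at the node `k` is a functional of `P (R_{-lam k} Φ)`.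
  let φ : L2Signal ν d → Fin dU → ℝ := fun Ψ => cellAverage lam 0 (f Ψ)
  have hφ : Continuous φ := (continuous_cellAverage hlam 0).comp hf
  let a : L2Signal ν d → gridCube ν N → Fin dU → ℝ :=
    fun Φ k => φ (P (translateL2 (-gridNode lam k.1) Φ))
  have ha : Continuous a := continuous_pi fun k =>
    hφ.comp (P.continuous.comp (continuous_translateL2 _))
  have haP : ∀ Φ, (gridSpace ν dU lam N).starProjection (f (P Φ))
      = gridToL2 lam N (extendZero (a Φ)) := by
    intro Φ
    rw [starProjection_gridSpace]
    refine (gridToL2_extendZero fun k => ?_).symm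
    have h1 : P (translateL2 (-gridNode lam k.1) Φ) = translateL2 (-gridNode lam k.1) (P Φ) := by
      rw [← gridNode_neg]
      exact starProjection_gridSpaceTop_translateL2 _ _
    simp only [a, φ]
    rw [h1, hfe, cellAverage_translateL2 hlam, zero_add, discretize_apply, if_pos k.2]
  obtain ⟨δ₃, hδ₃, hU⟩ := (hK.image ha).exists_delta_of_continuous
    ((continuous_gridToL2 (lam := lam) N).comp continuous_extendZero) hε4
  obtain ⟨net, hnet⟩ := exists_convLayers_approx_functional hσc hσ hL (lam := lam) N hφ hK
    (half_pos hδ₃)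
  refine ⟨lam, Lam, hlam, (min_le_left _ _).trans (min_le_left _ _), le_max_left _ _, net, ?_⟩
  refine lt_of_le_of_lt (iSup₂_le fun Φ hΦ => ?_)
    ((ENNReal.ofReal_lt_ofReal_iff hε).2 (show 3 * (ε / 4) < ε by linarith))
  rw [← ofReal_norm]
  refine ENNReal.ofReal_le_ofReal ?_
  let b : gridCube ν N → Fin dU → ℝ :=
    fun k => net.run σ L N (discretize lam (N + net.hiddenDepth * L) Φ) k.1
  have hb : basicConvnet σ L lam Lam net Φ = gridToL2 lam N (extendZero b) :=
    (gridToL2_extendZero fun k => rfl).symm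
  have h1 : ‖f Φ - (gridSpace ν dU lam N).starProjection (f Φ)‖ < ε / 4 :=
    happ₁ lam ((min_le_right _ _).trans (min_le_left _ _)) N hNlam _ ⟨Φ, hΦ, rfl⟩
  have h2 : dist ((gridSpace ν dU lam N).starProjection (f Φ))
      ((gridSpace ν dU lam N).starProjection (f (P Φ))) < ε / 4 := by
    refine lt_of_le_of_lt ?_ (hfδ Φ hΦ _ (hP Φ hΦ))
    simpa using ((gridSpace ν dU lam N).lipschitzWith_starProjection).dist_le_mul (f Φ) (f (P Φ))
  have h3 : dist ((gridSpace ν dU lam N).starProjection (f (P Φ)))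
      (basicConvnet σ L lam Lam net Φ) < ε / 4 := by
    rw [haP, hb]
    refine hU _ ⟨Φ, hΦ, rfl⟩ _ (lt_of_le_of_lt ?_ (half_lt_self hδ₃))
    refine (dist_pi_le_iff (half_pos hδ₃).le).2 fun k => (dist_pi_le_iff (half_pos hδ₃).le).2
      fun n => ?_
    rw [dist_comm, Real.dist_eq]
    exact (hnet Φ hΦ k.1 k.2 n).le
  rw [← dist_eq_norm] at h1 ⊢
  have h4 := dist_triangle4 (f Φ) ((gridSpace ν dU lam N).starProjection (f Φ))
    ((gridSpace ν dU lam N).starProjection (f (P Φ))) (basicConvnet σ L lam Lam net Φ)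
  rw [dist_comm]
  linarith

end Sufficiency

/-! ### Limit points are continuous and equivariant -/

section Necessity

variable {ν d dU : ℕ}

theorem IsLimitPointOfBasicConvnets.exists_norm_sub_lt {σ : ℝ → ℝ}
    {f : L2Signal ν d → L2Signal ν dU} (hf : IsLimitPointOfBasicConvnets σ f)
    {K : Set (L2Signal ν d)} (hK : IsCompact K) {ε lam₀ Lam₀ : ℝ} (hε : 0 < ε) (hlam₀ : 0 < lam₀)
    (hLam₀ : 0 < Lam₀) :
    ∃ lam Lam : ℝ, 0 < lam ∧ lam ≤ lam₀ ∧ Lam₀ ≤ Lam ∧ ∃ net : ConvLayers ν d dU,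
      ∀ Φ ∈ K, ‖basicConvnet σ 1 lam Lam net Φ - f Φ‖ < ε := by
  obtain ⟨lam, Lam, h1, h2, h3, net, hnet⟩ := hf 1 one_pos K hK ε lam₀ Lam₀ hε hlam₀ hLam₀
  refine ⟨lam, Lam, h1, h2, h3, net, fun Φ hΦ => ?_⟩
  have h := (le_iSup₂ (f := fun Φ (_ : Φ ∈ K) => ‖basicConvnet σ 1 lam Lam net Φ - f Φ‖ₑ)
    Φ hΦ).trans_lt hnet
  rwa [← ofReal_norm, ENNReal.ofReal_lt_ofReal_iff hε] at h

/-- Limit points are uniform limits of continuous maps on every compact set; a convergent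
sequence together with its limit is compact. -/
theorem IsLimitPointOfBasicConvnets.continuous {σ : ℝ → ℝ} (hσ : Continuous σ)
    {f : L2Signal ν d → L2Signal ν dU} (hf : IsLimitPointOfBasicConvnets σ f) : Continuous f := by
  rw [continuous_iff_seqContinuous]
  intro x p hx
  have hK := hx.isCompact_insert_range
  have hcont : ContinuousOn f (insert p (Set.range x)) := by
    refine continuousOn_of_uniform_approx_of_continuousOn fun u hu => ?_
    obtain ⟨ε, hε, hεu⟩ := Metric.mem_uniformity_dist.1 hu
    obtain ⟨lam, Lam, hlam, -, -, net, hnet⟩ := hf.exists_norm_sub_lt hK hε one_pos one_pos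
    refine ⟨_, (continuous_basicConvnet hσ 1 hlam Lam net).continuousOn, fun Φ hΦ => hεu ?_⟩
    rw [dist_comm, dist_eq_norm]
    exact hnet Φ hΦ
  refine (hcont p (Set.mem_insert _ _)).tendsto.comp (tendsto_nhdsWithin_iff.2 ⟨hx, ?_⟩)
  exact Filter.Eventually.of_forall fun n => Set.mem_insert_of_mem _ ⟨n, rfl⟩

theorem inner_cellIndicator_eq_zero {lam lam' : ℝ} {j k : Fin ν → ℤ}
    (h : Disjoint (gridCell lam j) (gridCell lam' k)) (v w : EuclideanSpace ℝ (Fin d)) :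
    inner ℝ (cellIndicator lam j v) (cellIndicator lam' k w) = 0 := by
  rw [cellIndicator, cellIndicator, L2.inner_indicatorConstLp_indicatorConstLp _ _
    (volume_gridCell_ne_top lam j) (volume_gridCell_ne_top lam' k), h.inter_eq, measureReal_empty,
    zero_smul]

/-- A signal that is orthogonal to the indicators of all cells of all grids vanishes. -/
theorem eq_zero_of_inner_cellIndicator_eq_zero (x : L2Signal ν d)
    (hx : ∀ lam : ℝ, 0 < lam → ∀ (k : Fin ν → ℤ) (v : EuclideanSpace ℝ (Fin d)),
      inner ℝ x (cellIndicator lam k v) = 0) : x = 0 := by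
  by_contra hne
  have hpos : 0 < ‖x‖ := norm_pos_iff.2 hne
  obtain ⟨R, hR, δ, hδ, happ⟩ := exists_mem_gridSpace_norm_sub_lt x hpos
  obtain ⟨N, hN⟩ := exists_nat_ge (R / δ)
  obtain ⟨w, hw, hxw⟩ := happ δ hδ le_rfl N ((div_le_iff₀ hδ).1 hN)
  have h0 : inner ℝ x w = 0 := by
    refine Submodule.span_induction ?_ (inner_zero_right _) ?_ ?_ hw
    · rintro _ ⟨k, -, v, rfl⟩
      exact hx δ hδ k v
    · intro y z _ _ hy hz
      rw [inner_add_right, hy, hz, add_zero]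
    · intro a y _ hy
      rw [inner_smul_right, hy, mul_zero]
  have h1 : ‖x‖ * ‖x‖ = inner ℝ x (x - w) := by
    rw [inner_sub_right, h0, sub_zero, real_inner_self_eq_norm_mul_norm]
  have h2 := real_inner_le_norm x (x - w)
  nlinarith

/-- A convnet commutes with grid translations away from the boundary of the grid: the two sides
agree when tested against a cell inside a cube that is small compared with the grid. -/
theorem inner_basicConvnet_translateL2 (σ : ℝ → ℝ) (L : ℕ) {lam Lam R : ℝ} (hlam : 0 < lam)
    (net : ConvLayers ν d dU) (m : Fin ν → ℤ) (hLam : R + ‖gridNode lam m‖ + lam ≤ Lam)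
    (Φ : L2Signal ν d) {lam' : ℝ} {k : Fin ν → ℤ} (hk : ∀ θ ∈ gridCell lam' k, ∀ s, |θ s| ≤ R)
    (v : EuclideanSpace ℝ (Fin dU)) :
    inner ℝ (basicConvnet σ L lam Lam net (translateL2 (gridNode lam m) Φ))
        (cellIndicator lam' k v)
      = inner ℝ (translateL2 (gridNode lam m) (basicConvnet σ L lam Lam net Φ))
        (cellIndicator lam' k v) := by
  classical
  set N : ℕ := ⌊Lam / lam⌋₊ with hN
  have hNlam : Lam < (N + 1) * lam := by
    rw [← div_lt_iff₀ hlam]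
    exact Nat.lt_floor_add_one _
  -- Cells far from the origin are orthogonal to the test function.
  have hfar : ∀ (j : Fin ν → ℤ) (s : Fin ν) (c : EuclideanSpace ℝ (Fin dU)),
      (N + 1) * lam - ‖gridNode lam m‖ ≤ |(j s : ℝ)| * lam →
      inner ℝ (cellIndicator lam j c) (cellIndicator lam' k v) = 0 := by
    intro j s c hj
    refine inner_cellIndicator_eq_zero (Set.disjoint_left.2 fun θ hθj hθk => ?_) _ _
    have h1 := mem_gridCell.1 hθj s
    have h2 := hk θ hθk s
    have h3 : |(j s : ℝ)| * lam ≤ |θ s| + lam / 2 := by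
      have h4 : |(j s : ℝ) * lam - θ s| ≤ lam / 2 := by
        rw [abs_le]
        constructor <;> linarith [h1.1, h1.2]
      have h5 := abs_add_le ((j s : ℝ) * lam - θ s) (θ s)
      rw [sub_add_cancel, abs_mul, abs_of_pos hlam] at h5
      linarith
    linarith
  set Y := net.run σ L N (discretize lam (N + net.hiddenDepth * L) Φ)
  set Z := net.run σ L N (discretize lam (N + net.hiddenDepth * L)
    (translateL2 (gridNode lam m) Φ))
  have hZY : ∀ j ∈ gridCube ν N, j + m ∈ gridCube ν N → Z (j + m) = Y j := by
    intro j hj hjm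
    refine net.run_congr σ L hjm hj fun θ hθ => ?_
    rw [discretize_apply, discretize_apply, if_pos (add_mem_gridCube hjm hθ),
      if_pos (add_mem_gridCube hj hθ)]
    have := cellAverage_translateL2 hlam (j + m + θ) (-m) Φ
    rw [gridNode_neg, neg_neg] at this
    rw [this]
    congr 1
    abel
  have hl : basicConvnet σ L lam Lam net (translateL2 (gridNode lam m) Φ)
      = ∑ j ∈ gridCube ν N, cellIndicator lam j (WithLp.toLp 2 (Z j)) := rfl
  have hr : translateL2 (gridNode lam m) (basicConvnet σ L lam Lam net Φ)
      = ∑ j ∈ gridCube ν N, cellIndicator lam (j + m) (WithLp.toLp 2 (Y j)) := by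
    have : basicConvnet σ L lam Lam net Φ
        = ∑ j ∈ gridCube ν N, cellIndicator lam j (WithLp.toLp 2 (Y j)) := rfl
    rw [this, ← translateₗᵢ_apply, map_sum]
    exact Finset.sum_congr rfl fun j _ => translateL2_cellIndicator _ _ _
  rw [hl, hr, sum_inner, sum_inner]
  symm
  rw [← Finset.sum_filter_of_ne (p := fun j => j + m ∈ gridCube ν N)]
  -- Only the `j` with both `j` and `j + m` in `Z_N` contribute; for those `Z (j + m) = Y j`.
  · refine Finset.sum_of_injOn (fun j => j + m) (fun a _ b _ h => add_right_cancel h) ?_ ?_ ?_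
    · intro j hj
      exact (Finset.mem_filter.1 hj).2
    · intro j hj hjn
      have hjm : j - m ∉ gridCube ν N := fun h => hjn
        ⟨j - m, Finset.mem_filter.2 ⟨h, by simpa using hj⟩, sub_add_cancel _ _⟩
      rw [mem_gridCube] at hjm
      push Not at hjm
      obtain ⟨s, hs⟩ := hjm
      refine hfar j s _ ?_
      have h1 : (N : ℝ) + 1 ≤ |(j s : ℝ) - m s| := by exact_mod_cast hs
      have h2 := abs_sub (j s : ℝ) (m s)
      have h3 : |(m s : ℝ)| * lam ≤ ‖gridNode lam m‖ := by
        have := norm_le_pi_norm (gridNode lam m) s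
        rwa [gridNode, Real.norm_eq_abs, abs_mul, abs_of_pos hlam] at this
      nlinarith
    · intro j hj
      obtain ⟨h1, h2⟩ := Finset.mem_filter.1 hj
      rw [hZY j h1 h2]
  · intro j _ hne
    by_contra hjm
    rw [mem_gridCube] at hjm
    push Not at hjm
    obtain ⟨s, hs⟩ := hjm
    refine hne (hfar (j + m) s _ ?_)
    have h1 : (N : ℝ) + 1 ≤ |((j + m) s : ℝ)| := by exact_mod_cast hs
    have h2 := norm_nonneg (gridNode lam m)
    nlinarith

theorem IsLimitPointOfBasicConvnets.isTranslationEquivariant {σ : ℝ → ℝ} (hσ : Continuous σ)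
    {f : L2Signal ν d → L2Signal ν dU} (hf : IsLimitPointOfBasicConvnets σ f) :
    IsTranslationEquivariant f := by
  intro γ Φ
  have hfc := hf.continuous hσ
  rw [← sub_eq_zero]
  refine eq_zero_of_inner_cellIndicator_eq_zero _ fun lam' hlam' k v => ?_
  set x := f (translateL2 γ Φ) - translateL2 γ (f Φ) with hx
  set ψ := cellIndicator lam' k v
  obtain ⟨N', hN'⟩ := exists_mem_gridCube k
  let R : ℝ := (N' + 1) * lam'
  have hR : ∀ θ ∈ gridCell lam' k, ∀ s, |θ s| ≤ R := by
    intro θ hθ s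
    have h1 := mem_gridCell.1 hθ s
    have h2 : |(k s : ℝ)| ≤ N' := by exact_mod_cast mem_gridCube.1 hN' s
    rw [abs_le] at h2 ⊢
    constructor <;> simp only [R] <;> nlinarith [h1.1, h1.2, h2.1, h2.2]
  suffices H : ∀ ε > 0, |inner ℝ x ψ| ≤ 4 * ε * ‖ψ‖ by
    rw [← abs_eq_zero]
    refine le_antisymm (le_of_forall_pos_le_add fun η hη => ?_) (abs_nonneg _)
    refine (H (η / (4 * (‖ψ‖ + 1))) (by positivity)).trans ?_
    have h1 : 4 * (η / (4 * (‖ψ‖ + 1))) * (‖ψ‖ + 1) = η := by field_simp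
    have h2 : 0 < η / (4 * (‖ψ‖ + 1)) := by positivity
    linarith
  intro ε hε
  have hc₁ : Continuous fun γ' => f (translateL2 γ' Φ) := hfc.comp (continuous_translateL2_left Φ)
  obtain ⟨δ₁, hδ₁, h₁⟩ := Metric.continuousAt_iff.1 (hc₁.continuousAt (x := γ)) ε hε
  obtain ⟨δ₂, hδ₂, h₂⟩ := Metric.continuousAt_iff.1
    ((continuous_translateL2_left (f Φ)).continuousAt (x := γ)) ε hε
  let K : Set (L2Signal ν d) :=
    insert Φ ((fun γ' => translateL2 γ' Φ) '' Metric.closedBall γ 1)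
  have hK : IsCompact K :=
    ((isCompact_closedBall γ 1).image (continuous_translateL2_left Φ)).insert Φ
  let lam₀ : ℝ := min 1 (min δ₁ δ₂) / 2
  have hlam₀ : 0 < lam₀ := by positivity
  have hRpos : 0 ≤ R := by positivity
  obtain ⟨lam, Lam, hlam, hlamle, hLam, net, hnet⟩ := hf.exists_norm_sub_lt hK hε hlam₀
    (show 0 < R + ‖γ‖ + 2 by positivity)
  -- The grid vector `lam * m` next to `γ`.
  let m : Fin ν → ℤ := fun s => ⌊γ s / lam⌋
  have hm : dist (gridNode lam m) γ ≤ lam := by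
    refine (dist_pi_le_iff hlam.le).2 fun s => ?_
    have h3 := Int.floor_le (γ s / lam)
    have h4 := Int.lt_floor_add_one (γ s / lam)
    rw [le_div_iff₀ hlam] at h3
    rw [div_lt_iff₀ hlam] at h4
    rw [Real.dist_eq, abs_le]
    simp only [gridNode, m]
    constructor <;> linarith
  have hmin : 2 * lam₀ = min 1 (min δ₁ δ₂) := by
    simp only [lam₀]
    ring
  have hle1 : 2 * lam₀ ≤ 1 := hmin ▸ min_le_left _ _
  have hle2 : 2 * lam₀ ≤ δ₁ := hmin ▸ (min_le_right _ _).trans (min_le_left _ _)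
  have hle3 : 2 * lam₀ ≤ δ₂ := hmin ▸ (min_le_right _ _).trans (min_le_right _ _)
  have hnorm : ‖gridNode lam m‖ ≤ ‖γ‖ + lam := by
    have := norm_sub_norm_le (gridNode lam m) γ
    rw [dist_eq_norm] at hm
    linarith
  set μ := gridNode lam m with hμ
  set F := basicConvnet σ 1 lam Lam net
  -- `x` differs from a signal orthogonal to `ψ` by four terms of norm less than `ε`.
  have e1 : ‖f (translateL2 μ Φ) - f (translateL2 γ Φ)‖ < ε := by
    rw [← dist_eq_norm]
    exact h₁ (by linarith)
  have e2 : ‖translateL2 μ (f Φ) - translateL2 γ (f Φ)‖ < ε := by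
    rw [← dist_eq_norm]
    exact h₂ (by linarith)
  have e3 : ‖F (translateL2 μ Φ) - f (translateL2 μ Φ)‖ < ε :=
    hnet _ (Set.mem_insert_of_mem _ ⟨μ, Metric.mem_closedBall.2 (by linarith), rfl⟩)
  have e4 : ‖translateL2 μ (F Φ) - translateL2 μ (f Φ)‖ < ε := by
    rw [← translateL2_sub, norm_translateL2]
    exact hnet Φ (Set.mem_insert _ _)
  have h0 : inner ℝ (F (translateL2 μ Φ) - translateL2 μ (F Φ)) ψ = 0 := by
    rw [inner_sub_left, sub_eq_zero]
    exact inner_basicConvnet_translateL2 σ 1 hlam net m (by linarith) Φ hR v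
  have hsplit : x - (F (translateL2 μ Φ) - translateL2 μ (F Φ))
      = (translateL2 μ (F Φ) - translateL2 μ (f Φ))
        + (translateL2 μ (f Φ) - translateL2 γ (f Φ))
        - ((F (translateL2 μ Φ) - f (translateL2 μ Φ))
        + (f (translateL2 μ Φ) - f (translateL2 γ Φ))) := by
    rw [hx]
    abel
  have hle : ‖x - (F (translateL2 μ Φ) - translateL2 μ (F Φ))‖ ≤ 4 * ε := by
    rw [hsplit]
    refine (norm_sub_le _ _).trans ?_
    linarith [norm_add_le (translateL2 μ (F Φ) - translateL2 μ (f Φ))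
      (translateL2 μ (f Φ) - translateL2 γ (f Φ)),
      norm_add_le (F (translateL2 μ Φ) - f (translateL2 μ Φ))
        (f (translateL2 μ Φ) - f (translateL2 γ Φ))]
  calc |inner ℝ x ψ| = |inner ℝ (x - (F (translateL2 μ Φ) - translateL2 μ (F Φ))) ψ| := by
        rw [inner_sub_left x _ ψ, h0, sub_zero]
    _ ≤ _ := abs_real_inner_le_norm _ _
    _ ≤ 4 * ε * ‖ψ‖ := by gcongr

end Necessity

end

theorem mainTheorem2 (ν dV dU : ℕ) (σ : ℝ → ℝ) (hσ : Continuous σ)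
    (hσ_poly : ¬ ∃ p : Polynomial ℝ, ∀ x : ℝ, σ x = p.eval x)
    (f : L2Signal ν dV → L2Signal ν dU) :
    IsLimitPointOfBasicConvnets σ f ↔ IsTranslationEquivariant f ∧ Continuous f :=
  ⟨fun h => ⟨h.isTranslationEquivariant hσ, h.continuous hσ⟩,
    fun h => isLimitPointOfBasicConvnets_of_continuous hσ hσ_poly h.1 h.2⟩
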